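/- Let $d\ge 1$, $r>0$, $V_\infty\ge 0$, $0<p\le 2$, and write $\mathbf v=(v_x,v_\perp)\in\mathbb R\times\mathbb R^{d-1}$. A body, a cylinder parallel to the $x$-axis whose cross-section is the closed ball $D=\{|x_\perp|\le r\}\subset\mathbb R^{d-1}$, moves in the $x$-direction through a gas with initial density $f_0(\mathbf v)=a_0(v_x)b(v_\perp)$. Particles are reflected at its two ends by the kernel $K(\mathbf v,\mathbf u)=k(v_x,u_x)b(v_\perp)$. **Assumptions.** Let $\ell(w)=w^2+J(w)$ with $J(w)=\int_0^\infty v^2k(v,w)\,dv$. For some $\gamma_*>0$: 1. $a_0,b,k$ are nonnegative and continuous, $f_0$ is bounded, $a_0$ is even, $k$ is even in each variable, $\int b=1$, $b(0)>0$, and $\int_{v_x\ge 0}v_xK(\mathbf v,\mathbf u)\,d\mathbf v=|u_x|$ for all $\mathbf u$. 2. $k(v,u)$ is bounded on $\{v\in\mathbb R,\ |u|\le\gamma_*\}$. 3. There are $c,C>0$ with $c|u|^p\le J(u)\le C|u|^p$ for $|u|\le\gamma_*$; $J$ is $C^1$ on $\mathbb R\setminus\{0\}$ and strictly decreasing on $(-\infty,0)$.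 4. There is $M\in L^1(\mathbb R)$ with $k(v,z-y-V_\infty)a_0(z)\le M(z)$ for $|v|<2\gamma_*$, $|y|<\gamma_*$, $z\in\mathbb R$. 5. There is $N\in L^1(\mathbb R)$ such that for $|y|<\gamma_*$ and $z\in\mathbb R$: $\ell(z-y-V_\infty)a_0(z)\le N(z)$, and $|\ell'(z-y-V_\infty)|a_0(z)\le N(z)$ if $|z-V_\infty|\ge 2\gamma_*$. 6. (Irreversal Criterion) $\int_0^\infty k(0,z)a_0(z+V_\infty)\,dz>a_0(V_\infty)$. **The class $\mathcal W$.** Let $F_0(V)=|D|\left(\int_{u_x\le V}\ell(u_x-V)f_0(\mathbf u)\,d\mathbf u-\int_{u_x\ge V}\ell(u_x-V)f_0(\mathbf u)\,d\mathbf u\right)$. For $\gamma>0$ let $B_0$ and $B_\infty$ be the maximum and the minimum of $F_0'$ on $[V_\infty-\gamma,V_\infty+\gamma]$, $t_0=|\ln\gamma|$ and $\langle t\rangle=1+t$. For $A_+,A_->0$ let $\mathcal W=\mathcal W(\gamma,A_+,A_-)$ be the set of Lipschitz functions $W:[0,\infty)\to\mathbb R$ with $W(0)=V_\infty+\gamma$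 that are nonincreasing on $[0,t_0]$ and satisfy, for all $t\ge 0$, $$\gamma e^{-B_0t}+\frac{\gamma^{p+1}A_+}{t^{p+d}}\chi\{t\ge t_0+1\}\le W(t)-V_\infty\le\gamma e^{-B_\infty t}+\frac{\gamma^{p+1}A_-}{\langle t\rangle^{p+d}}.$$ **The precollision force.** For a body moving with velocity $W$, let $\langle W\rangle_{s,t}=\frac1{t-s}\int_s^tW$. Points of an end are given by $x_\perp\in D$. The incoming velocities at time $t$ are those with $u_x\ge W(t)$ at the left end and $u_x\le W(t)$ at the right end. A precollision of $(t,x_\perp,\mathbf u)$ is a time $s\in(0,t)$ with $u_x=\langle W\rangle_{s,t}$ and $x_\perp-(t-s)u_\perp\in D$; let $\tau$ be the supremum of the precollisions and $\xi=x_\perp-(t-\tau)u_\perp$. At each end the densities $f_-$ and $f_+$ before and after collisions are the least solution with values in $[0,\infty]$ of $$f_+(t,x_\perp;\mathbf v)=\int_{\mathbf u\text{ incoming}}k(v_x-W(t),u_x-W(t))\,b(v_\perp)\,f_-(t,x_\perp;\mathbf u)\,d\mathbf u,$$ $$f_-(t,x_\perp;\mathbf u)=\begin{cases}f_+(\tau,\xi;\mathbf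 u)&\text{if there is a precollision},\\ f_0(\mathbf u)&\text{otherwise.}\end{cases}$$ With $f_-^L,f_-^R$ the densities $f_-$ at the left and the right end, put $$R_W(t)=\int_D\int_{u_x\ge W(t)}\ell(u_x-W(t))\{f_0-f_-^L\}\,d\mathbf u\,dx_\perp+\int_D\int_{u_x\le W(t)}\ell(u_x-W(t))\{f_-^R-f_0\}\,d\mathbf u\,dx_\perp .$$ **Theorem (key estimate, irreversal case).** There are constants $c_1,C_2,C>0$, depending only on $d,r,a_0,b,k,V_\infty,p,\gamma_*$, such that for all $A_+,A_->0$ there is $\gamma_0>0$ such that for all $\gamma\in(0,\gamma_0)$, all $W\in\mathcal W(\gamma,A_+,A_-)$ and all $t\ge 0$, the densities $f_-$ are a.e. finite and the integrals defining $R_W(t)$ converge absolutely, and $$R_W(t)\le\left[-c_1\frac{\gamma^{p+1}}{t^{p+d}}+\frac{C_2\gamma^{p+1}A_-^{p+1}}{\langle t\rangle^{(p+d)(p+1)}}\right]\chi\{t\ge t_0\}\le 0,\qquad R_W(t)\ge-\frac{C(\gamma+\gamma^{p+1}A_-)^{p+1}}{\langle t\rangle^{p+d}} .$$ -/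

import Mathlib

open MeasureTheory Set
open scoped ENNReal NNReal

noncomputable section

namespace KineticBody

/-- The space `ℝ^{d-1}` of transverse vectors `x_⊥`, `v_⊥`. -/
abbrev Transverse (d : ℕ) : Type := EuclideanSpace ℝ (Fin (d - 1))

/-- Velocities `𝐯 = (v_x, v_⊥)` in `ℝ^d = ℝ × ℝ^{d-1}`. -/
abbrev Velocity (d : ℕ) : Type := ℝ × Transverse d

/-! ### Collision kernel and initial density

Here `a₀ : ℝ → ℝ`, `b : ℝ^{d-1} → ℝ` and `k : ℝ → ℝ → ℝ` are the factors in
`f₀(𝐯) = a₀(v_x) b(v_⊥)` and `K(𝐯, 𝐮) = k(v_x, u_x) b(v_⊥)`. -/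

/-- The initial density `f₀(𝐯) = a₀(v_x) b(v_⊥)`. -/
def initialDensity {d : ℕ} (a₀ : ℝ → ℝ) (b : Transverse d → ℝ) (v : Velocity d) : ℝ :=
  a₀ v.1 * b v.2

/-- The collision kernel `K(𝐯, 𝐮) = k(v_x, u_x) b(v_⊥)`. -/
def collisionKernel {d : ℕ} (k : ℝ → ℝ → ℝ) (b : Transverse d → ℝ) (v u : Velocity d) : ℝ :=
  k v.1 u.1 * b v.2

/-- The moment `∫_{v_x ≥ 0} v_x² k(v_x, u_x) dv_x`. -/
def secondMoment (k : ℝ → ℝ → ℝ) (u : ℝ) : ℝ :=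
  ∫ v in Ici (0 : ℝ), v ^ 2 * k v u

/-- `ℓ(w) = w² + ∫_{v_x ≥ 0} v_x² k(v_x, w) dv_x`. -/
def ell (k : ℝ → ℝ → ℝ) (w : ℝ) : ℝ :=
  w ^ 2 + secondMoment k w

/-- Structure: the factors are nonnegative and continuous, `f₀` is bounded, `a₀` is even,
`k` is even in each variable, `∫ b = 1` and `b(0) > 0`. -/
structure StructureAssumption {d : ℕ} (a₀ : ℝ → ℝ) (b : Transverse d → ℝ)
    (k : ℝ → ℝ → ℝ) : Prop where
  a₀_nonneg : ∀ u, 0 ≤ a₀ u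
  b_nonneg : ∀ y, 0 ≤ b y
  k_nonneg : ∀ v u, 0 ≤ k v u
  a₀_continuous : Continuous a₀
  b_continuous : Continuous b
  k_continuous : Continuous (Function.uncurry k)
  f₀_bounded : ∃ B : ℝ, ∀ v : Velocity d, initialDensity a₀ b v ≤ B
  a₀_even : ∀ u, a₀ (-u) = a₀ u
  k_even_left : ∀ v u, k (-v) u = k v u
  k_even_right : ∀ v u, k v (-u) = k v u
  b_integral : ∫ y, b y = 1
  b_zero_pos : 0 < b 0

/-- Conservation of mass, `∫_{v_x ≥ 0} v_x K(𝐯, 𝐮) d𝐯 = |u_x|`. -/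
def MassConservation {d : ℕ} (b : Transverse d → ℝ) (k : ℝ → ℝ → ℝ) : Prop :=
  ∀ u : Velocity d, ∫ v in {v : Velocity d | 0 ≤ v.1}, v.1 * collisionKernel k b v u = |u.1|

/-- Boundedness: `k(v_x, u_x)` is bounded for `|u_x| ≤ γ`, `v_x ∈ ℝ`. -/
def BoundednessAssumption (k : ℝ → ℝ → ℝ) (γ : ℝ) : Prop :=
  ∃ B : ℝ, ∀ u v : ℝ, |u| ≤ γ → k v u ≤ B

/-- Power law for the second moment of the kernel, with exponent `p`. (That the moment is even is a
consequence of the evenness of `k`.) -/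
structure PowerLawAssumption (k : ℝ → ℝ → ℝ) (p γ : ℝ) : Prop where
  two_sided : ∃ c C : ℝ, 0 < c ∧ 0 < C ∧ ∀ u : ℝ, |u| ≤ γ →
    c * |u| ^ p ≤ secondMoment k u ∧ secondMoment k u ≤ C * |u| ^ p
  contDiff : ContDiffOn ℝ 1 (secondMoment k) {u | u ≠ 0}
  strictAnti : StrictAntiOn (secondMoment k) (Iio 0)

/-- Integrability: a common integrable majorant of the products `k(v_x, z - y - V_∞) a₀(z)` for
`|v_x| < 2γ`, `|y| < γ`. -/
def IntegrabilityAssumption (a₀ : ℝ → ℝ) (k : ℝ → ℝ → ℝ) (Vinf γ : ℝ) : Prop :=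
  ∃ M : ℝ → ℝ, Integrable M ∧
    ∀ v y z : ℝ, |v| < 2 * γ → |y| < γ → k v (z - y - Vinf) * a₀ z ≤ M z

/-- Convergence of the integrals in the force `F₀(V)` and in its derivative, locally uniformly in
the sense of domination, for `V = V_∞ + y` with `|y| < γ`. The second bound is imposed only away
from `V_∞`, as `ℓ'` may be unbounded near `0`. -/
def ForceConvergence (a₀ : ℝ → ℝ) (k : ℝ → ℝ → ℝ) (Vinf γ : ℝ) : Prop :=
  ∃ N : ℝ → ℝ, Integrable N ∧
    ∀ y z : ℝ, |y| < γ →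
      ell k (z - y - Vinf) * a₀ z ≤ N z ∧
      (2 * γ ≤ |z - Vinf| → |deriv (ell k) (z - y - Vinf)| * a₀ z ≤ N z)

/-- The Irreversal Criterion `∫_0^∞ k(0, z) a₀(z + V_∞) dz > a₀(V_∞)`. -/
def IrreversalCriterion (a₀ : ℝ → ℝ) (k : ℝ → ℝ → ℝ) (Vinf : ℝ) : Prop :=
  a₀ Vinf < ∫ z in Ioi (0 : ℝ), k 0 z * a₀ (z + Vinf)

/-! ### The body

The body is a cylinder parallel to the `x`-axis whose cross-section is the closed ball of radius
`r` centred at `0` in `ℝ^{d-1}`. A point of one of its two ends at time `t` is given by its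
transverse component. -/

/-- The cross-section of the cylinder. -/
def crossSection (d : ℕ) (r : ℝ) : Set (Transverse d) := Metric.closedBall 0 r

/-- The force on a body with velocity `V` if every particle collided at most once:
`F₀(V) = |∂Ω_L| (∫_{u_x ≤ V} ℓ(u_x - V) f₀(𝐮) d𝐮 - ∫_{u_x ≥ V} ℓ(u_x - V) f₀(𝐮) d𝐮)`. -/
def onceForce {d : ℕ} (r : ℝ) (a₀ : ℝ → ℝ) (b : Transverse d → ℝ) (k : ℝ → ℝ → ℝ) (V : ℝ) : ℝ :=
  volume.real (crossSection d r) *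
    ((∫ u in {u : Velocity d | u.1 ≤ V}, ell k (u.1 - V) * initialDensity a₀ b u) -
      ∫ u in {u : Velocity d | V ≤ u.1}, ell k (u.1 - V) * initialDensity a₀ b u)

/-- `B_0 = max F₀'` over `[V_∞ - γ, V_∞ + γ]`. -/
def rateMax {d : ℕ} (r : ℝ) (a₀ : ℝ → ℝ) (b : Transverse d → ℝ) (k : ℝ → ℝ → ℝ)
    (Vinf γ : ℝ) : ℝ :=
  sSup (deriv (onceForce r a₀ b k) '' Icc (Vinf - γ) (Vinf + γ))

/-- `B_∞ = min F₀'` over `[V_∞ - γ, V_∞ + γ]`. -/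
def rateMin {d : ℕ} (r : ℝ) (a₀ : ℝ → ℝ) (b : Transverse d → ℝ) (k : ℝ → ℝ → ℝ)
    (Vinf γ : ℝ) : ℝ :=
  sInf (deriv (onceForce r a₀ b k) '' Icc (Vinf - γ) (Vinf + γ))

/-- `t₀ = |ln γ|`. -/
def startTime (γ : ℝ) : ℝ := |Real.log γ|

/-- `⟨t⟩ = 1 + t`. -/
def bracket (t : ℝ) : ℝ := 1 + t

/-- `g(t, γ) = -(e^{-B_0 t} + γ^p A_+ t^{-(p+d)} χ{t ≥ t₀ + 1})`. -/
def gFun (d : ℕ) (p B₀ Aplus γ t : ℝ) : ℝ :=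
  -(Real.exp (-B₀ * t) +
    if startTime γ + 1 ≤ t then γ ^ p * Aplus / t ^ (p + (d : ℝ)) else 0)

/-- `h(t, γ) = -(e^{-B_∞ t} + γ^p A_- ⟨t⟩^{-(p+d)})`. -/
def hFun (d : ℕ) (p Binf Aminus γ t : ℝ) : ℝ :=
  -(Real.exp (-Binf * t) + γ ^ p * Aminus / bracket t ^ (p + (d : ℝ)))

/-- The class `𝒲` of possible motions in the irreversal case. Motions are functions on `[0, ∞)`;
values at negative times play no role. -/
structure IsAdmissibleMotion {d : ℕ} (r : ℝ) (a₀ : ℝ → ℝ) (b : Transverse d → ℝ)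
    (k : ℝ → ℝ → ℝ) (Vinf p Aplus Aminus γ : ℝ) (W : ℝ → ℝ) : Prop where
  lipschitz : ∃ L : ℝ≥0, LipschitzOnWith L W (Ici 0)
  initial : W 0 = Vinf + γ
  decreasing : AntitoneOn W (Icc 0 (startTime γ))
  lower : ∀ t, 0 ≤ t →
    γ * hFun d p (rateMin r a₀ b k Vinf γ) Aminus γ t ≤ Vinf - W t
  upper : ∀ t, 0 ≤ t →
    Vinf - W t ≤ γ * gFun d p (rateMax r a₀ b k Vinf γ) Aplus γ t

/-! ### The gas density generated by a motion -/

/-- The two ends of the cylinder. -/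
inductive BodyEnd
  | left
  | right

/-- Horizontal velocities of the particles that hit the given end of a body of velocity `V`. -/
def incomingVelocities (V : ℝ) : BodyEnd → Set ℝ
  | BodyEnd.left => Ici V
  | BodyEnd.right => Iic V

/-- The average `⟨W⟩_{s,t}`. -/
def timeAverage (W : ℝ → ℝ) (s t : ℝ) : ℝ :=
  (t - s)⁻¹ * ∫ σ in s..t, W σ

/-- The times `s ∈ (0, t)` at which the backward free trajectory, with velocity `𝐮`, of a
particle located at time `t` at the point `x` of one end of the body meets that same end: the
horizontal displacements over `[s, t]` of particle and body agree, that is `u_x = ⟨W⟩_{s,t}`, and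
the transverse position at time `s` lies in the cross-section. (By convexity of the cross-section
such a particle has not met the opposite end or the lateral boundary in between.) -/
def precollisionTimes {d : ℕ} (r : ℝ) (W : ℝ → ℝ) (t : ℝ) (x : Transverse d) (u : Velocity d) :
    Set ℝ :=
  {s | 0 < s ∧ s < t ∧ u.1 = timeAverage W s t ∧ x - (t - s) • u.2 ∈ crossSection d r}

/-- Densities at one end of the body, as functions of time, (transverse) position, velocity. -/
abbrev EndDensity (d : ℕ) : Type := ℝ → Transverse d → Velocity d → ℝ≥0∞

/-- The law of reflection: the density after collision,
`f_+(t, 𝐱; 𝐯) = ∫ K(𝐯 - 𝐢W(t); 𝐮 - 𝐢W(t)) f_-(t, 𝐱; 𝐮) d𝐮`, the integral being over the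
velocities `𝐮` that are incoming at the given end. -/
def reflect {d : ℕ} (b : Transverse d → ℝ) (k : ℝ → ℝ → ℝ) (W : ℝ → ℝ) (e : BodyEnd)
    (fminus : EndDensity d) : EndDensity d := fun t x v =>
  ∫⁻ u in {u : Velocity d | u.1 ∈ incomingVelocities (W t) e},
    ENNReal.ofReal (collisionKernel k b (v.1 - W t, v.2) (u.1 - W t, u.2)) * fminus t x u

open Classical in
/-- Free transport between collisions: the density before collision is
`f_-(t, 𝐱; 𝐮) = f_+(τ, ξ; 𝐮)` if there is a precollision, the one closest to `t` taking place at
time `τ` and position `ξ`, and `f_-(t, 𝐱; 𝐮) = f₀(𝐮)` if there is none. -/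
def transport {d : ℕ} (r : ℝ) (a₀ : ℝ → ℝ) (b : Transverse d → ℝ) (W : ℝ → ℝ)
    (fplus : EndDensity d) : EndDensity d := fun t x u =>
  if (precollisionTimes r W t x u).Nonempty then
    fplus (sSup (precollisionTimes r W t x u))
      (x - (t - sSup (precollisionTimes r W t x u)) • u.2) u
  else ENNReal.ofReal (initialDensity a₀ b u)

/-- One reflection followed by free transport, as a monotone operator. -/
def collisionStep {d : ℕ} (r : ℝ) (a₀ : ℝ → ℝ) (b : Transverse d → ℝ) (k : ℝ → ℝ → ℝ)
    (W : ℝ → ℝ) (e : BodyEnd) : EndDensity d →o EndDensity d where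
  toFun fminus := transport r a₀ b W (reflect b k W e fminus)
  monotone' := by
    intro f g hfg t x u
    simp only [transport]
    split_ifs
    · exact lintegral_mono fun w => by
        dsimp only
        gcongr
        exact hfg _ _ _
    · exact le_rfl

/-- The density `f_-` before collisions at the end `e` of a body moving with velocity `W`: the
least nonnegative solution of the transport equation with the law of reflection at the body and
initial density `f₀`, that is, the sum of the contributions of all particles that have had
finitely many collisions. -/
def densityBefore {d : ℕ} (r : ℝ) (a₀ : ℝ → ℝ) (b : Transverse d → ℝ) (k : ℝ → ℝ → ℝ)
    (W : ℝ → ℝ) (e : BodyEnd) : EndDensity d :=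
  OrderHom.lfp (collisionStep r a₀ b k W e)

/-- The density `f_+` after collisions. -/
def densityAfter {d : ℕ} (r : ℝ) (a₀ : ℝ → ℝ) (b : Transverse d → ℝ) (k : ℝ → ℝ → ℝ)
    (W : ℝ → ℝ) (e : BodyEnd) : EndDensity d :=
  reflect b k W e (densityBefore r a₀ b k W e)

/-- `f_-` is obtained from `f_+` and `f₀` by free transport between collisions. -/
theorem densityBefore_eq {d : ℕ} (r : ℝ) (a₀ : ℝ → ℝ) (b : Transverse d → ℝ) (k : ℝ → ℝ → ℝ)
    (W : ℝ → ℝ) (e : BodyEnd) :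
    densityBefore r a₀ b k W e = transport r a₀ b W (densityAfter r a₀ b k W e) :=
  (OrderHom.map_lfp (collisionStep r a₀ b k W e)).symm

/-! ### The precollision force -/

/-- The force `R_W(t) = r_W^L(t) + r_W^R(t)` due to precollisions. -/
def precollisionForce {d : ℕ} (r : ℝ) (a₀ : ℝ → ℝ) (b : Transverse d → ℝ) (k : ℝ → ℝ → ℝ)
    (W : ℝ → ℝ) (t : ℝ) : ℝ :=
  (∫ x in crossSection d r, ∫ u in {u : Velocity d | W t ≤ u.1},
      ell k (u.1 - W t) *
        (initialDensity a₀ b u - (densityBefore r a₀ b k W BodyEnd.left t x u).toReal)) +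
    ∫ x in crossSection d r, ∫ u in {u : Velocity d | u.1 ≤ W t},
      ell k (u.1 - W t) *
        ((densityBefore r a₀ b k W BodyEnd.right t x u).toReal - initialDensity a₀ b u)

/-- `R_W(t)` is well defined: at both ends `f_-` is almost everywhere finite on the domain of
integration and the integrand is integrable. -/
def PrecollisionForceConverges {d : ℕ} (r : ℝ) (a₀ : ℝ → ℝ) (b : Transverse d → ℝ)
    (k : ℝ → ℝ → ℝ) (W : ℝ → ℝ) (t : ℝ) : Prop :=
  ∀ e : BodyEnd,
    (∀ᵐ q : Transverse d × Velocity d ∂(volume.restrict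
        (crossSection d r ×ˢ {u : Velocity d | u.1 ∈ incomingVelocities (W t) e})),
      densityBefore r a₀ b k W e t q.1 q.2 < ∞) ∧
    IntegrableOn (fun q : Transverse d × Velocity d =>
        ell k (q.2.1 - W t) *
          (initialDensity a₀ b q.2 - (densityBefore r a₀ b k W e t q.1 q.2).toReal))
      (crossSection d r ×ˢ {u : Velocity d | u.1 ∈ incomingVelocities (W t) e})

end KineticBody

end

/-!
The force due to precollisions is `R_W = -P_L + P_R`, where `P_L` and `P_R` (`endMomentum`) are the
integrals of `ℓ(u_x - W(t)) (f_- - f₀)` over the left and the right end. Without a precollision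
`f_- = f₀`, so that only precolliding velocities contribute.

*Size of the density.* The horizontal velocity of a precolliding particle is an average of `W` and
so lies in the interval `[V_∞, V_∞ + γ + γ^{p+1} A_-]`, which is short. Since `k` is bounded for
small incoming relative velocities, `f₀ + G b(u_⊥)` on this interval is a supersolution of the
equation for `f_-` when `G` is large (`densityBefore_le`, `exists_density_majorant`); hence
`|f_- - f₀| ≤ G b(u_⊥)`. In the other direction, precolliding particles at the left end come from
collisions with the undisturbed faster gas, and the Irreversal Criterion, stable by dominated
convergence (`exists_irreversal_gap`), gives `f_- - f₀ ≥ ε b(u_⊥)` there. Both bounds are collected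
in `exists_densityChange_bounds`. The density is measurable because it is the increasing limit of
the densities of particles with finitely many collisions (`measurable_densityBefore`).

*Momentum of the precolliding particles.* As `ℓ(w)` is of order `|w|^p`, a set of precolliding
velocities with horizontal deviation `θ` from `V_∞` and transverse part in `B` carries at most
`θ^{p+1} ∫_B b`. A precollision in the first half of `[0, t]` forces `|u_⊥| ≤ 4r/t` and
`θ = O((γ + γ^{p+1} A_-)/t)`, one in the second half forces
`θ = O((γ + γ^{p+1} A_-) t^{-(p+d)})`; both lead to the factor `t^{-(p+1)-(d-1)} = t^{-(p+d)}` of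
the lower bound (`exists_precollision_majorant`). Conversely, by the intermediate value theorem all
velocities between `W(t)` and the average of `W` over `[0, t]`, which exceeds `V_∞` by at least a
constant times `γ/t`, with `|u_⊥| ≤ r/(2t)` do precollide at the left end, so that `P_L` is at least
a constant times `γ^{p+1} t^{-(p+d)}` (`exists_le_endMomentum_left`). At the right end
`V_∞ ≤ u_x ≤ W(t)`, whence `P_R = O((W(t) - V_∞)^{p+1})`, and `P_R = 0` as long as `W` decreases;
for `t ≥ t₀ = |ln γ|` the exponential part of `W - V_∞` is negligible.

The decay of the exponentials in the definition of the class of motions rests on `F₀' > 0` near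
`V_∞`. Because `ℓ'` may be singular at `0`, the differentiability of `F₀` is obtained from the
continuity of a convolution with `ℓ'` (`hasDerivAt_integral_comp_sub_mul`, `exists_rate_bounds`).
-/

namespace KineticBody

open Filter Topology

/-! ### The momentum weight `ℓ` -/

section Ell

variable {k : ℝ → ℝ → ℝ} {p γs : ℝ}

theorem secondMoment_neg (hk : ∀ v u, k v (-u) = k v u) (u : ℝ) :
    secondMoment k (-u) = secondMoment k u := by
  simp only [secondMoment, hk]

theorem secondMoment_nonneg (hk : ∀ v u, 0 ≤ k v u) (u : ℝ) : 0 ≤ secondMoment k u :=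
  integral_nonneg fun v => mul_nonneg (sq_nonneg v) (hk v u)

theorem secondMoment_zero (hk : ∀ v u, 0 ≤ k v u) (hp : 0 < p) (hγs : 0 < γs)
    (hPow : PowerLawAssumption k p γs) : secondMoment k 0 = 0 := by
  obtain ⟨c, C, -, -, h⟩ := hPow.two_sided
  have h0 := (h 0 (by simpa using hγs.le)).2
  rw [abs_zero, Real.zero_rpow hp.ne', mul_zero] at h0
  exact le_antisymm h0 (secondMoment_nonneg hk 0)

theorem ell_nonneg (hk : ∀ v u, 0 ≤ k v u) (u : ℝ) : 0 ≤ ell k u :=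
  add_nonneg (sq_nonneg u) (secondMoment_nonneg hk u)

theorem ell_zero (hk : ∀ v u, 0 ≤ k v u) (hp : 0 < p) (hγs : 0 < γs)
    (hPow : PowerLawAssumption k p γs) : ell k 0 = 0 := by
  simp [ell, secondMoment_zero hk hp hγs hPow]

theorem differentiableAt_secondMoment (hPow : PowerLawAssumption k p γs) {u : ℝ} (hu : u ≠ 0) :
    DifferentiableAt ℝ (secondMoment k) u :=
  (hPow.contDiff.differentiableOn one_ne_zero).differentiableAt
    (isOpen_ne.mem_nhds hu)

theorem continuous_secondMoment (hk : ∀ v u, 0 ≤ k v u) (hp : 0 < p) (hγs : 0 < γs)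
    (hPow : PowerLawAssumption k p γs) : Continuous (secondMoment k) := by
  rw [continuous_iff_continuousAt]
  intro u
  by_cases hu : u = 0
  · subst hu
    obtain ⟨c, C, -, -, h⟩ := hPow.two_sided
    rw [ContinuousAt, secondMoment_zero hk hp hγs hPow]
    have hlim : Tendsto (fun u : ℝ => C * |u| ^ p) (𝓝 0) (𝓝 0) := by
      have : ContinuousAt (fun u : ℝ => C * |u| ^ p) 0 :=
        continuousAt_const.mul (continuous_abs.continuousAt.rpow_const (Or.inr hp.le))
      simpa [ContinuousAt, Real.zero_rpow hp.ne'] using this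
    refine squeeze_zero' (Eventually.of_forall fun u => secondMoment_nonneg hk u) ?_ hlim
    filter_upwards [Metric.closedBall_mem_nhds (0 : ℝ) hγs] with u hu
    exact (h u (by simpa using hu)).2
  · exact (differentiableAt_secondMoment hPow hu).continuousAt

theorem continuous_ell (hk : ∀ v u, 0 ≤ k v u) (hp : 0 < p) (hγs : 0 < γs)
    (hPow : PowerLawAssumption k p γs) : Continuous (ell k) :=
  (continuous_pow 2).add (continuous_secondMoment hk hp hγs hPow)

/-- Near zero `ℓ(w)` is comparable with `|w|^p`; the term `w²` is absorbed because `p ≤ 2`. -/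
theorem exists_ell_two_sided (hp : 0 < p) (hp2 : p ≤ 2) (hγs : 0 < γs)
    (hPow : PowerLawAssumption k p γs) :
    ∃ c C : ℝ, 0 < c ∧ 0 < C ∧ ∀ w, |w| ≤ γs → c * |w| ^ p ≤ ell k w ∧ ell k w ≤ C * |w| ^ p := by
  obtain ⟨c, C, hc, hC, h⟩ := hPow.two_sided
  refine ⟨c, γs ^ (2 - p) + C, hc, by positivity, fun w hw => ⟨?_, ?_⟩⟩
  · have := (h w hw).1
    simp only [ell]
    nlinarith [sq_nonneg w]
  · have h2 : w ^ 2 ≤ γs ^ (2 - p) * |w| ^ p := by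
      rcases eq_or_ne w 0 with rfl | h0
      · simp [Real.zero_rpow, (show p ≠ 0 from hp.ne')]
      · calc w ^ 2 = |w| ^ ((2 - p) + p) := by
              rw [sub_add_cancel]; norm_num
    
          _ = |w| ^ (2 - p) * |w| ^ p := Real.rpow_add (abs_pos.2 h0) _ _
          _ ≤ γs ^ (2 - p) * |w| ^ p := by gcongr
    rw [ell, add_mul]
    exact add_le_add h2 (h w hw).2

theorem hasDerivAt_ell (hPow : PowerLawAssumption k p γs) {w : ℝ} (hw : w ≠ 0) :
    HasDerivAt (ell k) (2 * w + deriv (secondMoment k) w) w := by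
  have h1 : HasDerivAt (fun w : ℝ => w ^ 2) (2 * w) w := by simpa using hasDerivAt_pow 2 w
  exact h1.add (differentiableAt_secondMoment hPow hw).hasDerivAt

/-- The odd, nondecreasing function `sgn(w) ℓ(w)`: the momentum transferred by a particle of
relative velocity `w`, counted with its sign. -/
noncomputable def signedEll (k : ℝ → ℝ → ℝ) (w : ℝ) : ℝ := if 0 ≤ w then ell k w else -ell k w

theorem deriv_secondMoment_nonpos (hPow : PowerLawAssumption k p γs) {w : ℝ} (hw : w < 0) :
    deriv (secondMoment k) w ≤ 0 := by
  rw [← derivWithin_of_isOpen isOpen_Iio hw]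
  exact hPow.strictAnti.antitoneOn.derivWithin_nonpos

theorem deriv_secondMoment_nonneg (hk : ∀ v u, k v (-u) = k v u)
    (hPow : PowerLawAssumption k p γs) {w : ℝ} (hw : 0 < w) :
    0 ≤ deriv (secondMoment k) w := by
  have h : secondMoment k = fun u => secondMoment k (-u) := by
    funext u; rw [secondMoment_neg hk]
  rw [h, deriv_comp_neg]
  have := deriv_secondMoment_nonpos hPow (neg_lt_zero.2 hw)
  linarith

theorem signedEll_of_nonneg {w : ℝ} (hw : 0 ≤ w) : signedEll k w = ell k w := if_pos hw

theorem signedEll_of_neg {w : ℝ} (hw : w < 0) : signedEll k w = -ell k w := if_neg hw.not_ge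

theorem hasDerivAt_signedEll (hk : ∀ v u, k v (-u) = k v u)
    (hPow : PowerLawAssumption k p γs) {w : ℝ} (hw : w ≠ 0) :
    HasDerivAt (signedEll k) |deriv (ell k) w| w := by
  rw [(hasDerivAt_ell hPow hw).deriv]
  rcases lt_or_gt_of_ne hw with h | h
  · have h1 := deriv_secondMoment_nonpos hPow h
    rw [abs_of_nonpos (by linarith)]
    refine (hasDerivAt_ell hPow hw).neg.congr_of_eventuallyEq ?_
    filter_upwards [isOpen_Iio.mem_nhds h] with x hx using signedEll_of_neg hx
  · have h1 := deriv_secondMoment_nonneg hk hPow h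
    rw [abs_of_nonneg (by linarith)]
    refine (hasDerivAt_ell hPow hw).congr_of_eventuallyEq ?_
    filter_upwards [isOpen_Ioi.mem_nhds h] with x hx using signedEll_of_nonneg (le_of_lt hx)

theorem two_mul_abs_le_abs_deriv_ell (hk : ∀ v u, k v (-u) = k v u)
    (hPow : PowerLawAssumption k p γs) {w : ℝ} (hw : w ≠ 0) :
    2 * |w| ≤ |deriv (ell k) w| := by
  rw [(hasDerivAt_ell hPow hw).deriv]
  rcases lt_or_gt_of_ne hw with h | h
  · have h1 := deriv_secondMoment_nonpos hPow h
    rw [abs_of_nonpos (a := 2 * w + _) (by linarith), abs_of_neg h]; linarith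
  · have h1 := deriv_secondMoment_nonneg hk hPow h
    rw [abs_of_nonneg (a := 2 * w + _) (by linarith), abs_of_pos h]; linarith

theorem continuous_signedEll (hk : ∀ v u, 0 ≤ k v u) (hp : 0 < p) (hγs : 0 < γs)
    (hPow : PowerLawAssumption k p γs) : Continuous (signedEll k) := by
  have hc := continuous_ell hk hp hγs hPow
  refine Continuous.if_le hc hc.neg continuous_const continuous_id ?_
  rintro x rfl
  simp [ell_zero hk hp hγs hPow]

theorem monotone_signedEll (hk : ∀ v u, 0 ≤ k v u) (hk' : ∀ v u, k v (-u) = k v u)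
    (hp : 0 < p) (hγs : 0 < γs) (hPow : PowerLawAssumption k p γs) :
    Monotone (signedEll k) := by
  have hc := continuous_signedEll hk hp hγs hPow
  have h1 : MonotoneOn (signedEll k) (Iic 0) := by
    refine monotoneOn_of_deriv_nonneg (convex_Iic 0) hc.continuousOn ?_ ?_
    · intro x hx
      rw [interior_Iic] at hx
      exact (hasDerivAt_signedEll hk' hPow (ne_of_lt hx)).differentiableAt.differentiableWithinAt
    · intro x hx
      rw [interior_Iic] at hx
      rw [(hasDerivAt_signedEll hk' hPow (ne_of_lt hx)).deriv]
      exact abs_nonneg _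
  have h2 : MonotoneOn (signedEll k) (Ici 0) := by
    refine monotoneOn_of_deriv_nonneg (convex_Ici 0) hc.continuousOn ?_ ?_
    · intro x hx
      rw [interior_Ici] at hx
      exact (hasDerivAt_signedEll hk' hPow (ne_of_gt hx)).differentiableAt.differentiableWithinAt
    · intro x hx
      rw [interior_Ici] at hx
      rw [(hasDerivAt_signedEll hk' hPow (ne_of_gt hx)).deriv]
      exact abs_nonneg _
  exact h1.Iic_union_Ici h2

theorem deriv_signedEll_nonneg (hk : ∀ v u, 0 ≤ k v u) (hk' : ∀ v u, k v (-u) = k v u)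
    (hp : 0 < p) (hγs : 0 < γs) (hPow : PowerLawAssumption k p γs) (w : ℝ) :
    0 ≤ deriv (signedEll k) w :=
  (monotone_signedEll hk hk' hp hγs hPow).deriv_nonneg

theorem intervalIntegrable_deriv_signedEll (hk : ∀ v u, 0 ≤ k v u)
    (hk' : ∀ v u, k v (-u) = k v u) (hp : 0 < p) (hγs : 0 < γs)
    (hPow : PowerLawAssumption k p γs) (a b : ℝ) :
    IntervalIntegrable (deriv (signedEll k)) volume a b :=
  ((monotone_signedEll hk hk' hp hγs hPow).monotoneOn _).intervalIntegrable_deriv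

/-- The fundamental theorem of calculus for `sgn(w) ℓ(w)`, whose derivative may be singular
at `0`. -/
theorem integral_deriv_signedEll (hk : ∀ v u, 0 ≤ k v u)
    (hk' : ∀ v u, k v (-u) = k v u) (hp : 0 < p) (hγs : 0 < γs)
    (hPow : PowerLawAssumption k p γs) (a b : ℝ) :
    ∫ w in a..b, deriv (signedEll k) w = signedEll k b - signedEll k a := by
  refine integral_eq_of_hasDerivAt_off_countable _ _ (countable_singleton (0 : ℝ))
    (continuous_signedEll hk hp hγs hPow).continuousOn ?_
    (intervalIntegrable_deriv_signedEll hk hk' hp hγs hPow a b)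
  rintro x ⟨-, hx⟩
  exact (hasDerivAt_signedEll hk' hPow hx).differentiableAt.hasDerivAt

end Ell

/-! ### Differentiability of the force `F₀` -/

section OnceForce

/-- Differentiation under the integral sign when the kernel `L` is only a primitive of a locally
integrable function `l`. The integrand has no dominated difference quotients near the
singularities of `l`; instead the increment is written as an iterated integral, whose inner part
is a convolution of `l` with a continuous function of compact support and hence continuous. -/
theorem hasDerivAt_integral_comp_sub_mul {L l α : ℝ → ℝ} (hLc : Continuous L)
    (hl : ∀ a b, IntervalIntegrable l volume a b) (hL : ∀ a b, ∫ w in a..b, l w = L b - L a)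
    (hα : Continuous α) (hαc : HasCompactSupport α) :
    Continuous (fun V => ∫ u, l (u - V) * α u) ∧
      ∀ V, Integrable (fun u => l (u - V) * α u) ∧
        HasDerivAt (fun V => ∫ u, L (u - V) * α u) (-∫ u, l (u - V) * α u) V := by
  have hl' : ∀ a b, IntervalIntegrable (fun w => l (-w)) volume a b := fun a b => by
    have := (hl (-a) (-b)).comp_mul_left (c := -1)
    simpa using this
  have hloc : LocallyIntegrable (fun w => l (-w)) volume := by
    rw [locallyIntegrable_iff]
    intro K hK
    obtain ⟨R, hR⟩ := hK.isBounded.subset_closedBall 0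
    rw [Real.closedBall_eq_Icc] at hR
    rcases le_total (0 - R) (0 + R) with h | h
    · exact ((intervalIntegrable_iff_integrableOn_Icc_of_le h).1 (hl' _ _)).mono_set hR
    · have : K ⊆ {0 + R} := fun x hx => le_antisymm (hR hx).2 (h.trans (hR hx).1)
      exact (integrableOn_singleton (by simp) (by simp)).mono_set this
  have hconv : (fun V => ∫ u, l (u - V) * α u)
      = (convolution α (fun w => l (-w)) (ContinuousLinearMap.mul ℝ ℝ) volume) := by
    funext V
    simp only [convolution, ContinuousLinearMap.mul_apply', neg_sub, mul_comm]
  have hcont : Continuous (fun V => ∫ u, l (u - V) * α u) := by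
    rw [hconv]
    exact hαc.continuous_convolution_left _ hα hloc
  refine ⟨hcont, fun V₀ => ⟨?_, ?_⟩⟩
  · have h : ConvolutionExists α (fun w => l (-w)) (ContinuousLinearMap.mul ℝ ℝ) volume :=
      hαc.convolutionExists_left _ hα hloc
    have := h V₀
    simp only [ConvolutionExistsAt, ContinuousLinearMap.mul_apply', neg_sub] at this
    simpa only [mul_comm] using this
  have hint : ∀ V, Integrable (fun u => L (u - V) * α u) := fun V =>
    Continuous.integrable_of_hasCompactSupport (by fun_prop) hαc.mul_left
  have key : ∀ V, ∫ u, L (u - V) * α u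
      = (∫ u, L (u - V₀) * α u) - ∫ y in V₀..V, ∫ u, l (u - y) * α u := by
    intro V
    obtain ⟨R, hR⟩ := hαc.isBounded.subset_closedBall 0
    have hswap : ∫ y in V₀..V, ∫ u, l (u - y) * α u = ∫ u, ∫ y in V₀..V, l (u - y) * α u := by
      refine intervalIntegral_integral_swap ?_
      -- truncation of `l` makes the integrand a convolution integrand of integrable functions
      set R' := |R| + |V₀| + |V| with hR'
      have hR0 : -R' ≤ R' := by have : 0 ≤ R' := by positivity
                                linarith
      have hg : Integrable ((Icc (-R') R').indicator fun w => l (-w)) :=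
        (integrable_indicator_iff measurableSet_Icc).2
          ((intervalIntegrable_iff_integrableOn_Icc_of_le hR0).1 (hl' _ _))
      have hprod := (hα.integrable_of_hasCompactSupport (μ := volume) hαc).convolution_integrand
        (ContinuousLinearMap.mul ℝ ℝ) hg
      have hres := hprod.mono_measure
        (Measure.prod_mono (Measure.restrict_le_self (s := uIoc V₀ V)) le_rfl)
      refine hres.congr ?_
      have hae : ∀ᵐ q : ℝ × ℝ ∂((volume.restrict (uIoc V₀ V)).prod volume), q.1 ∈ uIoc V₀ V :=
        Measure.quasiMeasurePreserving_fst.ae (ae_restrict_mem measurableSet_uIoc)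
      filter_upwards [hae] with q hq
      simp only [ContinuousLinearMap.mul_apply', Function.uncurry]
      by_cases hz : α q.2 = 0
      · simp [hz]
      · have h2 : |q.2| ≤ R := by
          have := hR (subset_tsupport α hz)
          simpa using this
        have h3 : |q.1| ≤ |V₀| + |V| := by
          have h1 := hq
          rw [uIoc, mem_Ioc] at h1
          rw [abs_le]
          constructor
          · rcases min_cases V₀ V with h | h <;>
            · have := neg_abs_le V₀; have := neg_abs_le V
              have := abs_nonneg V; have := abs_nonneg V₀
              linarith [h.1 ▸ h1.1]
          · rcases max_cases V₀ V with h | h <;>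
            · have := le_abs_self V₀; have := le_abs_self V
              have := abs_nonneg V; have := abs_nonneg V₀
              linarith [h.1 ▸ h1.2]
        have h4 : q.1 - q.2 ∈ Icc (-R') R' := by
          rw [mem_Icc, ← abs_le]
          calc |q.1 - q.2| ≤ |q.1| + |q.2| := abs_sub _ _
            _ ≤ R' := by have := le_abs_self R; linarith
        rw [indicator_of_mem h4, neg_sub, mul_comm]
    rw [hswap, ← integral_sub (hint V₀)]
    · congr 1
      funext u
      rw [intervalIntegral.integral_mul_const, intervalIntegral.integral_comp_sub_left, hL]
      ring
    · have : (fun u => ∫ y in V₀..V, l (u - y) * α u)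
          = fun u => L (u - V₀) * α u - L (u - V) * α u := by
        funext u
        rw [intervalIntegral.integral_mul_const, intervalIntegral.integral_comp_sub_left, hL]
        ring
      rw [this]
      exact (hint V₀).sub (hint V)
  have hfun : (fun V => ∫ u, L (u - V) * α u)
      = fun V => (∫ u, L (u - V₀) * α u) - ∫ y in V₀..V, ∫ u, l (u - y) * α u := funext key
  rw [hfun]
  have := intervalIntegral.integral_hasDerivAt_right (hcont.intervalIntegrable V₀ V₀)
    (hcont.stronglyMeasurableAtFilter _ _) hcont.continuousAt
  simpa using this.const_sub (∫ u, L (u - V₀) * α u)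

variable {d : ℕ} {a₀ : ℝ → ℝ} {b : Transverse d → ℝ} {k : ℝ → ℝ → ℝ} {Vinf p γs r : ℝ}

theorem integrable_b (hS : StructureAssumption a₀ b k) : Integrable b := by
  by_contra h
  have := hS.b_integral
  rw [integral_undef h] at this
  exact zero_ne_one this

theorem integrable_ell_mul (hS : StructureAssumption a₀ b k) (hp : 0 < p) (hγs : 0 < γs)
    (hPow : PowerLawAssumption k p γs) (hF : ForceConvergence a₀ k Vinf γs) {V : ℝ}
    (hV : |V - Vinf| < γs) : Integrable fun x => ell k (x - V) * a₀ x := by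
  obtain ⟨N, hN, h⟩ := hF
  have hc := continuous_ell hS.k_nonneg hp hγs hPow
  have ha := hS.a₀_continuous
  refine hN.mono' (by fun_prop) (Eventually.of_forall fun x => ?_)
  rw [Real.norm_of_nonneg (mul_nonneg (ell_nonneg hS.k_nonneg _) (hS.a₀_nonneg _))]
  have := (h (V - Vinf) x hV).1
  rwa [show x - (V - Vinf) - Vinf = x - V by ring] at this

/-- The force `F₀` as a one-dimensional integral against the signed momentum weight. -/
theorem onceForce_eq (hS : StructureAssumption a₀ b k) (hp : 0 < p) (hγs : 0 < γs)
    (hPow : PowerLawAssumption k p γs) (hF : ForceConvergence a₀ k Vinf γs) {V : ℝ}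
    (hV : |V - Vinf| < γs) :
    onceForce r a₀ b k V
      = volume.real (crossSection d r) * -∫ x, signedEll k (x - V) * a₀ x := by
  have hint := integrable_ell_mul hS hp hγs hPow hF hV
  have hsplit : ∀ s : Set ℝ, ∫ u in {u : Velocity d | u.1 ∈ s},
      ell k (u.1 - V) * initialDensity a₀ b u = ∫ x in s, ell k (x - V) * a₀ x := by
    intro s
    have hs : {u : Velocity d | u.1 ∈ s} = s ×ˢ univ := by ext; simp
    have := setIntegral_prod_mul (μ := (volume : Measure ℝ))
      (ν := (volume : Measure (Transverse d))) (fun x => ell k (x - V) * a₀ x) b s univ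
    rw [setIntegral_univ, hS.b_integral, mul_one] at this
    rw [← this, hs, Measure.volume_eq_prod]
    simp only [initialDensity, mul_assoc]
  have h1 := hsplit (Iic V)
  have h2 := hsplit (Ici V)
  simp only [mem_Iic, mem_Ici] at h1 h2
  have hsgn : Integrable fun x => signedEll k (x - V) * a₀ x := by
    have hc := continuous_signedEll hS.k_nonneg hp hγs hPow
    have ha := hS.a₀_continuous
    refine hint.mono (by fun_prop) (Eventually.of_forall fun x => ?_)
    rw [norm_mul, norm_mul, signedEll]
    split_ifs <;> simp
  rw [onceForce, h1, h2, integral_Ici_eq_integral_Ioi]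
  congr 1
  rw [← intervalIntegral.integral_Iic_add_Ioi (b := V) hsgn.integrableOn hsgn.integrableOn]
  have e1 : ∫ x in Iic V, signedEll k (x - V) * a₀ x = -∫ x in Iic V, ell k (x - V) * a₀ x := by
    rw [← integral_neg]
    refine setIntegral_congr_fun measurableSet_Iic fun x hx => ?_
    rcases (mem_Iic.1 hx).lt_or_eq with h | rfl
    · simp only [signedEll_of_neg (sub_neg.2 h), neg_mul]
    · simp [signedEll, ell_zero hS.k_nonneg hp hγs hPow]
  have e2 : ∫ x in Ioi V, signedEll k (x - V) * a₀ x = ∫ x in Ioi V, ell k (x - V) * a₀ x := by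
    refine setIntegral_congr_fun measurableSet_Ioi fun x hx => ?_
    simp only [signedEll_of_nonneg (sub_nonneg.2 (le_of_lt (mem_Ioi.1 hx)))]
  rw [e1, e2]
  ring

/-- Near `V_∞` the force `F₀` is differentiable, with derivative `|D| ∫ |ℓ'(u - V)| a₀(u) du`.
The integral over `|u - V_∞| < 2γ_*` is treated by `hasDerivAt_integral_comp_sub_mul`, the rest by
domination. -/
theorem exists_hasDerivAt_onceForce (hS : StructureAssumption a₀ b k) (hp : 0 < p)
    (hγs : 0 < γs) (hPow : PowerLawAssumption k p γs) (hF : ForceConvergence a₀ k Vinf γs) :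
    ∃ K : ℝ, ∀ V, |V - Vinf| ≤ γs / 2 →
      Integrable (fun u => deriv (signedEll k) (u - V) * a₀ u) ∧
      (∫ u, deriv (signedEll k) (u - V) * a₀ u) ≤ K ∧
      HasDerivAt (onceForce r a₀ b k)
        (volume.real (crossSection d r) * ∫ u, deriv (signedEll k) (u - V) * a₀ u) V := by
  have ha := hS.a₀_continuous
  have hLc := continuous_signedEll hS.k_nonneg hp hγs hPow
  have hl0 := deriv_signedEll_nonneg hS.k_nonneg hS.k_even_right hp hγs hPow
  set φ : ℝ → ℝ := fun u => max 0 (min 1 (3 - |u - Vinf| / γs)) with hφ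
  have hφc : Continuous φ := by fun_prop
  have hφ0 : ∀ u, 0 ≤ φ u := fun u => le_max_left _ _
  have hφ1 : ∀ u, φ u ≤ 1 := fun u => max_le zero_le_one (min_le_left _ _)
  have hφin : ∀ u, |u - Vinf| < 2 * γs → φ u = 1 := fun u hu => by
    have : |u - Vinf| / γs ≤ 2 := by rw [div_le_iff₀ hγs]; exact hu.le
    simp only [hφ]
    rw [min_eq_left (by linarith), max_eq_right zero_le_one]
  have hφsupp : HasCompactSupport φ := by
    refine HasCompactSupport.intro (isCompact_closedBall Vinf (3 * γs)) fun u hu => ?_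
    rw [Metric.mem_closedBall, Real.dist_eq, not_le] at hu
    have : 3 ≤ |u - Vinf| / γs := by rw [le_div_iff₀ hγs]; exact hu.le
    simp only [hφ]
    exact max_eq_left ((min_le_right _ _).trans (by linarith))
  obtain ⟨hnc, hnear⟩ := hasDerivAt_integral_comp_sub_mul hLc
    (intervalIntegrable_deriv_signedEll hS.k_nonneg hS.k_even_right hp hγs hPow)
    (integral_deriv_signedEll hS.k_nonneg hS.k_even_right hp hγs hPow)
    (hφc.mul ha) (hφsupp.mul_right)
  simp only [Pi.mul_apply] at hnc hnear
  have hF' := hF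
  obtain ⟨N, hN, hNb⟩ := hF'
  have hbound : ∀ u V, |V - Vinf| < γs →
      |deriv (signedEll k) (u - V) * ((1 - φ u) * a₀ u)| ≤ |N u| := by
    intro u V hV
    by_cases hu : |u - Vinf| < 2 * γs
    · simp [hφin u hu]
    · have hne : u - V ≠ 0 := by
        intro h
        have : u = V := by linarith
        subst this
        linarith
      rw [abs_of_nonneg (mul_nonneg (hl0 _)
        (mul_nonneg (by linarith [hφ1 u]) (hS.a₀_nonneg _))),
        (hasDerivAt_signedEll hS.k_even_right hPow hne).deriv]
      have h1 := (hNb (V - Vinf) u hV).2 (not_lt.1 hu)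
      rw [show u - (V - Vinf) - Vinf = u - V by ring] at h1
      refine le_trans ?_ (h1.trans (le_abs_self _))
      refine mul_le_mul_of_nonneg_left ?_ (abs_nonneg _)
      have := mul_nonneg (hφ0 u) (hS.a₀_nonneg u)
      linarith
  have hsgn : ∀ V, |V - Vinf| < γs → Integrable fun x => signedEll k (x - V) * a₀ x := by
    intro V hV
    refine (integrable_ell_mul hS hp hγs hPow hF hV).mono (by fun_prop)
      (Eventually.of_forall fun x => ?_)
    rw [norm_mul, norm_mul, signedEll]
    split_ifs <;> simp
  have hfarint : ∀ V, |V - Vinf| < γs →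
      Integrable fun x => signedEll k (x - V) * ((1 - φ x) * a₀ x) := by
    intro V hV
    refine (hsgn V hV).mono (by fun_prop) (Eventually.of_forall fun x => ?_)
    rw [norm_mul, norm_mul, norm_mul, Real.norm_of_nonneg (by linarith [hφ1 x] : 0 ≤ 1 - φ x)]
    refine mul_le_mul_of_nonneg_left ?_ (norm_nonneg _)
    nlinarith [norm_nonneg (a₀ x), hφ0 x]
  have hfar : ∀ V, |V - Vinf| < γs →
      Integrable (fun u => -deriv (signedEll k) (u - V) * ((1 - φ u) * a₀ u)) ∧
      HasDerivAt (fun V => ∫ u, signedEll k (u - V) * ((1 - φ u) * a₀ u))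
        (∫ u, -deriv (signedEll k) (u - V) * ((1 - φ u) * a₀ u)) V := by
    intro V hV
    have hmem : {V : ℝ | |V - Vinf| < γs} ∈ 𝓝 V :=
      (isOpen_lt (by fun_prop) continuous_const).mem_nhds hV
    refine hasDerivAt_integral_of_dominated_loc_of_deriv_le
      (F := fun V u => signedEll k (u - V) * ((1 - φ u) * a₀ u))
      (F' := fun V u => -deriv (signedEll k) (u - V) * ((1 - φ u) * a₀ u))
      (bound := fun u => |N u|) hmem ?_ (hfarint V hV) ?_ ?_ hN.abs ?_
    · exact Eventually.of_forall fun V => by fun_prop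
    · have hm := measurable_deriv (signedEll k)
      have h1 : Measurable fun u => deriv (signedEll k) (u - V) :=
        hm.comp (measurable_id.sub_const V)
      have h2 : Measurable fun u => (1 - φ u) * a₀ u :=
        (by fun_prop : Continuous fun u => (1 - φ u) * a₀ u).measurable
      exact (h1.neg.mul h2).aestronglyMeasurable
    · refine Eventually.of_forall fun u y hy => ?_
      rw [neg_mul, norm_neg]
      exact hbound u y hy
    · refine Eventually.of_forall fun u y hy => ?_
      by_cases hu : |u - Vinf| < 2 * γs
      · simpa [hφin u hu] using hasDerivAt_const y (0 : ℝ)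
      · have hne : u - y ≠ 0 := by
          intro h
          have : u = y := by linarith
          subst this
          exact hu (lt_trans hy (by linarith))
        have h1 := (hasDerivAt_signedEll hS.k_even_right hPow hne).differentiableAt.hasDerivAt
        have h2 : HasDerivAt (fun y : ℝ => u - y) (-1) y := by
          simpa using (hasDerivAt_id y).const_sub u
        have h3 := (h1.comp y h2).mul_const ((1 - φ u) * a₀ u)
        simpa using h3
  obtain ⟨K₁, hK₁⟩ := (isCompact_closedBall Vinf (γs / 2)).exists_bound_of_continuousOn
    hnc.continuousOn
  refine ⟨K₁ + ∫ u, |N u|, fun V hV => ?_⟩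
  have hV' : |V - Vinf| < γs := by linarith
  obtain ⟨hni, hnd⟩ := hnear V
  obtain ⟨hfi, hfd⟩ := hfar V hV'
  have hfi' : Integrable (fun u => deriv (signedEll k) (u - V) * ((1 - φ u) * a₀ u)) := by
    simpa using hfi.neg
  have hsum : (fun u => deriv (signedEll k) (u - V) * a₀ u) = fun u =>
      deriv (signedEll k) (u - V) * (φ u * a₀ u)
        + deriv (signedEll k) (u - V) * ((1 - φ u) * a₀ u) := by
    funext u; ring
  have hint : Integrable (fun u => deriv (signedEll k) (u - V) * a₀ u) := by
    rw [hsum]; exact hni.add hfi'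
  have hval : ∫ u, deriv (signedEll k) (u - V) * a₀ u
      = (∫ u, deriv (signedEll k) (u - V) * (φ u * a₀ u))
        + ∫ u, deriv (signedEll k) (u - V) * ((1 - φ u) * a₀ u) := by
    rw [hsum]; exact integral_add hni hfi'
  refine ⟨hint, ?_, ?_⟩
  · rw [hval]
    refine add_le_add ((le_abs_self _).trans (hK₁ V ?_)) ?_
    · simpa [Real.dist_eq] using hV
    · exact integral_mono hfi' hN.abs fun u => (le_abs_self _).trans (hbound u V hV')
  · have h := ((hnd.add hfd).neg.const_mul (volume.real (crossSection d r)))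
    have hev : onceForce r a₀ b k =ᶠ[𝓝 V] fun V => volume.real (crossSection d r) *
        -((∫ u, signedEll k (u - V) * (φ u * a₀ u))
          + ∫ u, signedEll k (u - V) * ((1 - φ u) * a₀ u)) := by
      filter_upwards [(isOpen_lt (by fun_prop : Continuous fun V : ℝ => |V - Vinf|)
        continuous_const).mem_nhds hV'] with y hy
      have hni : Integrable fun u => signedEll k (u - y) * (φ u * a₀ u) :=
        Continuous.integrable_of_hasCompactSupport (by fun_prop)
          (HasCompactSupport.mul_left (HasCompactSupport.mul_right hφsupp))
      rw [onceForce_eq hS hp hγs hPow hF hy, ← integral_add hni (hfarint y hy)]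
      congr 3
      funext u
      ring
    refine (h.congr_of_eventuallyEq hev).congr_deriv ?_
    rw [hval]
    simp only [neg_mul, integral_neg]
    ring

/-- The derivative of `F₀` is bounded and bounded away from `0` near `V_∞`. For the lower bound
`|ℓ'(w)| ≥ 2|w|` is used on an interval where `a₀` is bounded below; such an interval exists by
the Irreversal Criterion. -/
theorem exists_rate_bounds (hr : 0 < r) (hS : StructureAssumption a₀ b k) (hp : 0 < p)
    (hγs : 0 < γs) (hPow : PowerLawAssumption k p γs) (hF : ForceConvergence a₀ k Vinf γs)
    (hIrr : IrreversalCriterion a₀ k Vinf) :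
    ∃ β K γ₁ : ℝ, 0 < β ∧ 0 < K ∧ 0 < γ₁ ∧ ∀ γ, 0 < γ → γ ≤ γ₁ →
      β ≤ rateMin r a₀ b k Vinf γ ∧ rateMax r a₀ b k Vinf γ ≤ K := by
  obtain ⟨K, hK⟩ := exists_hasDerivAt_onceForce (r := r) hS hp hγs hPow hF
  have hvol : 0 < volume.real (crossSection d r) :=
    ENNReal.toReal_pos (Metric.measure_closedBall_pos volume _ hr).ne'
      (measure_closedBall_lt_top).ne
  have hz : ∃ z > 0, 0 < a₀ (z + Vinf) := by
    by_contra! hcon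
    have : ∫ z in Ioi (0 : ℝ), k 0 z * a₀ (z + Vinf) = 0 := by
      refine setIntegral_eq_zero_of_forall_eq_zero fun z hz => ?_
      rw [le_antisymm (hcon z hz) (hS.a₀_nonneg _), mul_zero]
    have h2 := hIrr
    rw [IrreversalCriterion, this] at h2
    exact absurd h2 (hS.a₀_nonneg _).not_gt
  obtain ⟨z, hz0, hz⟩ := hz
  obtain ⟨ρ, hρ, hρb⟩ := Metric.continuous_iff.1 hS.a₀_continuous (z + Vinf)
    (a₀ (z + Vinf) / 2) (by positivity)
  set ε := a₀ (z + Vinf) / 2 with hε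
  set ρ' := min (ρ / 2) (z / 4) with hρ'
  have hρ'0 : 0 < ρ' := by positivity
  set β := (ε * z) * (2 * ρ') with hβ
  have hlow : ∀ V, |V - Vinf| ≤ min (γs / 2) (z / 4) →
      β ≤ ∫ u, deriv (signedEll k) (u - V) * a₀ u := by
    intro V hV
    obtain ⟨hi, -, -⟩ := hK V (hV.trans (min_le_left _ _))
    have hnn : ∀ u, 0 ≤ deriv (signedEll k) (u - V) * a₀ u := fun u => mul_nonneg
      (deriv_signedEll_nonneg hS.k_nonneg hS.k_even_right hp hγs hPow _) (hS.a₀_nonneg _)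
    calc β = ∫ u in Icc (z + Vinf - ρ') (z + Vinf + ρ'), ε * z := by
          rw [setIntegral_const, Real.volume_real_Icc_of_le (by linarith), smul_eq_mul]
          ring
      _ ≤ ∫ u in Icc (z + Vinf - ρ') (z + Vinf + ρ'), deriv (signedEll k) (u - V) * a₀ u := by
          refine setIntegral_mono_on (integrableOn_const (by simp)) hi.integrableOn
            measurableSet_Icc fun u hu => ?_
          have hu' : |u - (z + Vinf)| ≤ ρ' := by
            rw [abs_le]; constructor <;> linarith [hu.1, hu.2]
          have h1 : ε ≤ a₀ u := by
            have := hρb u (by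
              rw [Real.dist_eq]
              exact hu'.trans_lt ((min_le_left _ _).trans_lt (by linarith)))
            rw [Real.dist_eq, abs_lt] at this
            linarith [this.1]
          have h2 : z / 2 ≤ u - V := by
            have h3 := abs_le.1 (hV.trans (min_le_right _ _))
            have h4 := hu.1
            have h5 : ρ' ≤ z / 4 := min_le_right _ _
            linarith [h3.2]
          have h3 : u - V ≠ 0 := by linarith
          rw [mul_comm ε z, (hasDerivAt_signedEll hS.k_even_right hPow h3).deriv]
          refine mul_le_mul ?_ h1 (by positivity) (abs_nonneg _)
          refine le_trans ?_ (two_mul_abs_le_abs_deriv_ell hS.k_even_right hPow h3)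
          rw [abs_of_pos (by linarith)]
          linarith
      _ ≤ ∫ u, deriv (signedEll k) (u - V) * a₀ u :=
          setIntegral_le_integral hi (Eventually.of_forall hnn)
  refine ⟨volume.real (crossSection d r) * β, volume.real (crossSection d r) * |K| + 1,
    min (γs / 2) (z / 4), by positivity, by positivity, by positivity, fun γ hγ0 hγ => ?_⟩
  have hmem : ∀ V ∈ Icc (Vinf - γ) (Vinf + γ), |V - Vinf| ≤ min (γs / 2) (z / 4) := by
    intro V hV
    refine le_trans ?_ hγ
    rw [abs_le]; constructor <;> linarith [hV.1, hV.2]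
  have hne : (deriv (onceForce r a₀ b k) '' Icc (Vinf - γ) (Vinf + γ)).Nonempty :=
    (nonempty_Icc.2 (by linarith)).image _
  constructor
  · refine le_csInf hne ?_
    rintro _ ⟨V, hV, rfl⟩
    obtain ⟨-, -, hd⟩ := hK V ((hmem V hV).trans (min_le_left _ _))
    rw [hd.deriv]
    exact mul_le_mul_of_nonneg_left (hlow V (hmem V hV)) hvol.le
  · refine csSup_le hne ?_
    rintro _ ⟨V, hV, rfl⟩
    obtain ⟨-, hb, hd⟩ := hK V ((hmem V hV).trans (min_le_left _ _))
    rw [hd.deriv]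
    have := mul_le_mul_of_nonneg_left (hb.trans (le_abs_self K)) hvol.le
    linarith

end OnceForce

/-! ### Precollision times -/

section Precollision

variable {d : ℕ} {r : ℝ} {W W' : ℝ → ℝ} {t : ℝ} {x : Transverse d} {u : Velocity d}

theorem timeAverage_congr (h : EqOn W W' (Ici 0)) {s t : ℝ} (hs : 0 < s) (hst : s < t) :
    timeAverage W s t = timeAverage W' s t := by
  rw [timeAverage, timeAverage, intervalIntegral.integral_congr]
  intro σ hσ
  rw [uIcc_of_le hst.le] at hσ
  exact h (hs.le.trans hσ.1)

theorem precollisionTimes_congr (h : EqOn W W' (Ici 0)) :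
    precollisionTimes r W t x u = precollisionTimes r W' t x u := by
  ext s
  simp only [precollisionTimes, mem_ofPred_eq]
  refine and_congr_right fun hs => and_congr_right fun hst => ?_
  rw [timeAverage_congr h hs hst]

theorem bddAbove_precollisionTimes : BddAbove (precollisionTimes r W t x u) :=
  ⟨t, fun _ hs => hs.2.1.le⟩

theorem sSup_precollisionTimes_pos (h : (precollisionTimes r W t x u).Nonempty) :
    0 < sSup (precollisionTimes r W t x u) := by
  obtain ⟨s, hs⟩ := h
  exact hs.1.trans_le (le_csSup bddAbove_precollisionTimes hs)

theorem transport_of_nonempty {a₀ : ℝ → ℝ} {b : Transverse d → ℝ} {f : EndDensity d}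
    (h : (precollisionTimes r W t x u).Nonempty) :
    transport r a₀ b W f t x u = f (sSup (precollisionTimes r W t x u))
      (x - (t - sSup (precollisionTimes r W t x u)) • u.2) u := if_pos h

theorem transport_of_not_nonempty {a₀ : ℝ → ℝ} {b : Transverse d → ℝ} {f : EndDensity d}
    (h : ¬(precollisionTimes r W t x u).Nonempty) :
    transport r a₀ b W f t x u = ENNReal.ofReal (initialDensity a₀ b u) := if_neg h

/-- Motions that agree for nonnegative times generate the same densities. -/
theorem collisionStep_congr {a₀ : ℝ → ℝ} {b : Transverse d → ℝ} {k : ℝ → ℝ → ℝ} {e : BodyEnd}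
    (h : EqOn W W' (Ici 0)) :
    collisionStep r a₀ b k W e = collisionStep r a₀ b k W' e := by
  ext f t x u
  change transport r a₀ b W (reflect b k W e f) t x u
    = transport r a₀ b W' (reflect b k W' e f) t x u
  have hP := precollisionTimes_congr (r := r) (t := t) (x := x) (u := u) h
  by_cases hne : (precollisionTimes r W t x u).Nonempty
  · rw [transport_of_nonempty hne, transport_of_nonempty (hP ▸ hne), hP]
    simp only [reflect, h (sSup_precollisionTimes_pos (hP ▸ hne)).le]
  · rw [transport_of_not_nonempty hne, transport_of_not_nonempty (hP ▸ hne)]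

theorem densityBefore_congr {a₀ : ℝ → ℝ} {b : Transverse d → ℝ} {k : ℝ → ℝ → ℝ} {e : BodyEnd}
    (h : EqOn W W' (Ici 0)) :
    densityBefore r a₀ b k W e = densityBefore r a₀ b k W' e := by
  rw [densityBefore, densityBefore, collisionStep_congr h]

theorem timeAverage_le {s t M : ℝ} (hst : s < t) (hW : Continuous W)
    (h : ∀ σ ∈ Icc s t, W σ ≤ M) : timeAverage W s t ≤ M := by
  have h1 : ∫ σ in s..t, W σ ≤ ∫ _ in s..t, M :=
    intervalIntegral.integral_mono_on hst.le (hW.intervalIntegrable _ _) (by simp) h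
  rw [intervalIntegral.integral_const, smul_eq_mul] at h1
  rw [timeAverage, inv_mul_le_iff₀ (sub_pos.2 hst)]
  exact h1

theorem le_timeAverage {s t m : ℝ} (hst : s < t) (hW : Continuous W)
    (h : ∀ σ ∈ Icc s t, m ≤ W σ) : m ≤ timeAverage W s t := by
  have h1 : ∫ _ in s..t, m ≤ ∫ σ in s..t, W σ :=
    intervalIntegral.integral_mono_on hst.le (by simp) (hW.intervalIntegrable _ _) h
  rw [intervalIntegral.integral_const, smul_eq_mul] at h1
  rw [timeAverage, le_inv_mul_iff₀ (sub_pos.2 hst)]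
  exact h1

theorem fst_mem_of_precollision {m M : ℝ} (hW : Continuous W) (hI : ∀ t, W t ∈ Icc m M)
    (h : (precollisionTimes r W t x u).Nonempty) : u.1 ∈ Icc m M := by
  obtain ⟨s, -, hst, hu, -⟩ := h
  rw [hu]
  exact ⟨le_timeAverage hst hW fun σ _ => (hI σ).1, timeAverage_le hst hW fun σ _ => (hI σ).2⟩

theorem measurableSet_exists_lt {X : Type*} [TopologicalSpace X] [MeasurableSpace X]
    [OpensMeasurableSpace X] {F : Set (ℝ × X)} (hF : IsClosed F) {T : X → ℝ} (hT : Continuous T)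
    (a : ℝ) : MeasurableSet {q : X | ∃ s, a < s ∧ s < T q ∧ (s, q) ∈ F} := by
  have hset : {q : X | ∃ s, a < s ∧ s < T q ∧ (s, q) ∈ F} = ⋃ n : ℕ,
      Prod.snd '' {z : Icc (a + 1 / (n + 1 : ℝ)) n × X |
        (z.1 : ℝ) ≤ T z.2 - 1 / (n + 1 : ℝ) ∧ ((z.1 : ℝ), z.2) ∈ F} := by
    ext q
    simp only [mem_ofPred_eq, mem_iUnion, mem_image, Prod.exists, exists_eq_right]
    constructor
    · rintro ⟨s, has, hsT, hs⟩
      obtain ⟨n, hn⟩ := exists_nat_one_div_lt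
        (lt_min (sub_pos.2 has) (sub_pos.2 hsT))
      obtain ⟨m, hm⟩ := exists_nat_ge s
      have h1 : 1 / ((max n m : ℕ) + 1 : ℝ) ≤ 1 / (n + 1 : ℝ) := by
        gcongr; exact le_max_left _ _
      have h2 : (m : ℝ) ≤ (max n m : ℕ) := by exact_mod_cast le_max_right _ _
      have h3 := hn.trans_le (min_le_left _ _)
      have h4 := hn.trans_le (min_le_right _ _)
      exact ⟨max n m, ⟨s, by linarith, by linarith⟩, by simp only; linarith, hs⟩
    · rintro ⟨n, ⟨s, hs1, hs2⟩, hsT, hs⟩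
      have : (0 : ℝ) < 1 / (n + 1 : ℝ) := by positivity
      exact ⟨s, by linarith, by simp only at hsT; linarith, hs⟩
  rw [hset]
  refine MeasurableSet.iUnion fun n => ?_
  refine (isClosedMap_snd_of_compactSpace _ ?_).measurableSet
  rw [ofPred_and]
  refine IsClosed.inter (isClosed_le (by fun_prop) (by fun_prop)) ?_
  exact hF.preimage (f := fun z : Icc (a + 1 / (n + 1 : ℝ)) (n : ℝ) × X => ((z.1 : ℝ), z.2))
    (by fun_prop)

theorem measurableSet_exists_precollision (hW : Continuous W) {a : ℝ} (ha : 0 ≤ a) :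
    MeasurableSet {q : ℝ × Transverse d × Velocity d |
      ∃ s ∈ precollisionTimes r W q.1 q.2.1 q.2.2, a < s} := by
  have hprim : Continuous fun t => ∫ σ in (0 : ℝ)..t, W σ :=
    intervalIntegral.continuous_primitive (fun _ _ => hW.intervalIntegrable _ _) 0
  have hF : IsClosed {z : ℝ × ℝ × Transverse d × Velocity d |
      z.2.2.2.1 * (z.2.1 - z.1) = (∫ σ in (0 : ℝ)..z.2.1, W σ) - ∫ σ in (0 : ℝ)..z.1, W σ ∧
        ‖z.2.2.1 - (z.2.1 - z.1) • z.2.2.2.2‖ ≤ r} := by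
    rw [ofPred_and]
    refine IsClosed.inter (isClosed_eq (by fun_prop) ?_) (isClosed_le (by fun_prop) (by fun_prop))
    exact (hprim.comp (by fun_prop)).sub (hprim.comp (by fun_prop))
  convert measurableSet_exists_lt hF continuous_fst a using 1
  ext ⟨t, x, u⟩
  simp only [precollisionTimes, mem_ofPred_eq, crossSection, mem_closedBall_zero_iff, timeAverage]
  refine exists_congr fun s => ?_
  have hsub := intervalIntegral.integral_interval_sub_left (μ := volume)
    (hW.intervalIntegrable 0 t) (hW.intervalIntegrable 0 s)
  rw [hsub]
  constructor
  · rintro ⟨⟨-, h2, h3, h4⟩, h5⟩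
    refine ⟨h5, h2, ?_, h4⟩
    rw [h3]
    field_simp [(sub_pos.2 h2).ne']
  · rintro ⟨h1, h2, h3, h4⟩
    refine ⟨⟨ha.trans_lt h1, h2, ?_, h4⟩, h1⟩
    rw [← h3]
    field_simp [(sub_pos.2 h2).ne']

theorem measurable_sSup_precollisionTimes (hW : Continuous W) :
    Measurable fun q : ℝ × Transverse d × Velocity d =>
      sSup (precollisionTimes r W q.1 q.2.1 q.2.2) := by
  refine measurable_of_Ioi fun a => ?_
  rcases le_or_gt 0 a with ha | ha
  · convert measurableSet_exists_precollision (r := r) (d := d) hW ha using 1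
    ext ⟨t, x, u⟩
    simp only [mem_preimage, mem_Ioi, mem_ofPred_eq]
    constructor
    · intro h
      rcases (precollisionTimes r W t x u).eq_empty_or_nonempty with h0 | h0
      · rw [h0, Real.sSup_empty] at h
        exact absurd h ha.not_gt
      · exact exists_lt_of_lt_csSup h0 h
    · rintro ⟨s, hs, has⟩
      exact has.trans_le (le_csSup bddAbove_precollisionTimes hs)
  · convert MeasurableSet.univ
    ext q
    simp only [mem_preimage, mem_Ioi, mem_univ, iff_true]
    exact ha.trans_le (Real.sSup_nonneg fun s hs => hs.1.le)

end Precollision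

/-! ### Measurability of the density -/

section Measurability

variable {d : ℕ} {r : ℝ} {W : ℝ → ℝ} {a₀ : ℝ → ℝ} {b : Transverse d → ℝ} {k : ℝ → ℝ → ℝ}
  {e : BodyEnd}

/-- A density viewed as a function of a single variable. -/
def EndDensity.uncurry (f : EndDensity d) (q : ℝ × Transverse d × Velocity d) : ℝ≥0∞ :=
  f q.1 q.2.1 q.2.2

theorem measurableSet_nonempty_precollisionTimes (hW : Continuous W) :
    MeasurableSet {q : ℝ × Transverse d × Velocity d |
      (precollisionTimes r W q.1 q.2.1 q.2.2).Nonempty} := by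
  convert measurableSet_exists_precollision (r := r) (d := d) hW le_rfl using 1
  ext q
  exact exists_congr fun s => ⟨fun h => ⟨h, h.1⟩, fun h => h.1⟩

theorem measurable_initialDensity (hS : StructureAssumption a₀ b k) :
    Measurable (initialDensity a₀ b) := by
  have h1 := hS.a₀_continuous
  have h2 := hS.b_continuous
  have : Continuous (initialDensity a₀ b) := by unfold initialDensity; fun_prop
  exact this.measurable

theorem measurable_transport (hS : StructureAssumption a₀ b k) (hW : Continuous W)
    {f : EndDensity d} (hf : Measurable f.uncurry) :
    Measurable (EndDensity.uncurry (transport r a₀ b W f)) := by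
  classical
  have hτ := measurable_sSup_precollisionTimes (r := r) (d := d) hW
  have h1 : Measurable fun q : ℝ × Transverse d × Velocity d =>
      f.uncurry (sSup (precollisionTimes r W q.1 q.2.1 q.2.2),
        q.2.1 - (q.1 - sSup (precollisionTimes r W q.1 q.2.1 q.2.2)) • q.2.2.2, q.2.2) := by
    refine hf.comp (hτ.prodMk (Measurable.prodMk ?_ (by fun_prop)))
    exact measurable_snd.fst.sub ((measurable_fst.sub hτ).smul (by fun_prop))
  have h2 : Measurable fun q : ℝ × Transverse d × Velocity d =>
      ENNReal.ofReal (initialDensity a₀ b q.2.2) :=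
    ((measurable_initialDensity hS).comp (by fun_prop)).ennreal_ofReal
  suffices h : EndDensity.uncurry (transport r a₀ b W f)
      = fun q => if (precollisionTimes r W q.1 q.2.1 q.2.2).Nonempty then
        f.uncurry (sSup (precollisionTimes r W q.1 q.2.1 q.2.2),
          q.2.1 - (q.1 - sSup (precollisionTimes r W q.1 q.2.1 q.2.2)) • q.2.2.2, q.2.2)
        else ENNReal.ofReal (initialDensity a₀ b q.2.2) by
    rw [h]
    exact Measurable.ite (measurableSet_nonempty_precollisionTimes hW) h1 h2
  funext q
  by_cases hne : (precollisionTimes r W q.1 q.2.1 q.2.2).Nonempty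
  · rw [if_pos hne, EndDensity.uncurry, transport_of_nonempty hne]; rfl
  · rw [if_neg hne, EndDensity.uncurry, transport_of_not_nonempty hne]

theorem measurableSet_incoming (hW : Continuous W) :
    MeasurableSet {z : (ℝ × Transverse d × Velocity d) × Velocity d |
      z.2.1 ∈ incomingVelocities (W z.1.1) e} := by
  have h1 : Measurable fun z : (ℝ × Transverse d × Velocity d) × Velocity d => z.2.1 := by
    fun_prop
  have h2 : Measurable fun z : (ℝ × Transverse d × Velocity d) × Velocity d => W z.1.1 :=
    hW.measurable.comp (by fun_prop)
  cases e
  · exact measurableSet_le h2 h1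
  · exact measurableSet_le h1 h2

theorem measurableSet_incoming_slice (V : ℝ) :
    MeasurableSet {u : Velocity d | u.1 ∈ incomingVelocities V e} := by
  cases e
  · exact measurableSet_le measurable_const measurable_fst
  · exact measurableSet_le measurable_fst measurable_const

theorem measurable_reflect_kernel (hS : StructureAssumption a₀ b k) (hW : Continuous W) :
    Measurable fun z : (ℝ × Transverse d × Velocity d) × Velocity d =>
      ENNReal.ofReal (collisionKernel k b (z.1.2.2.1 - W z.1.1, z.1.2.2.2)
        (z.2.1 - W z.1.1, z.2.2)) := by
  have h1 := hS.k_continuous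
  have h2 := hS.b_continuous
  have h3 : Continuous fun z : (ℝ × Transverse d × Velocity d) × Velocity d =>
      Function.uncurry k (z.1.2.2.1 - W z.1.1, z.2.1 - W z.1.1) * b z.1.2.2.2 := by fun_prop
  exact h3.measurable.ennreal_ofReal

theorem measurable_reflect (hS : StructureAssumption a₀ b k) (hW : Continuous W)
    {f : EndDensity d} (hf : Measurable f.uncurry) :
    Measurable (EndDensity.uncurry (reflect b k W e f)) := by
  have h1 : Measurable fun z : (ℝ × Transverse d × Velocity d) × Velocity d =>
      {z : (ℝ × Transverse d × Velocity d) × Velocity d |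
        z.2.1 ∈ incomingVelocities (W z.1.1) e}.indicator (fun z =>
          ENNReal.ofReal (collisionKernel k b (z.1.2.2.1 - W z.1.1, z.1.2.2.2)
            (z.2.1 - W z.1.1, z.2.2)) * f.uncurry (z.1.1, z.1.2.1, z.2)) z :=
    ((measurable_reflect_kernel hS hW).mul (hf.comp (by fun_prop))).indicator
      (measurableSet_incoming hW)
  convert h1.lintegral_prod_right' (ν := volume) using 1
  funext q
  rw [EndDensity.uncurry, reflect, ← lintegral_indicator (measurableSet_incoming_slice _)]
  rfl

/-- The density is the limit of the densities of particles with at most `n` collisions. All of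
these are measurable, so that monotone convergence shows that their limit is the least fixed
point. -/
theorem measurable_densityBefore (hS : StructureAssumption a₀ b k) (hW : Continuous W) :
    Measurable (EndDensity.uncurry (densityBefore r a₀ b k W e)) := by
  set Φ := collisionStep r a₀ b k W e with hΦ
  set f : ℕ → EndDensity d := fun n => Φ^[n] ⊥ with hf
  have hsucc : ∀ n, f (n + 1) = Φ (f n) := fun n => Function.iterate_succ_apply' _ _ _
  have hmeas : ∀ n, Measurable (f n).uncurry := by
    intro n
    induction n with
    | zero => exact measurable_const (a := (0 : ℝ≥0∞))
    | succ n ih =>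
      rw [hsucc]
      exact measurable_transport hS hW (measurable_reflect hS hW ih)
  have hmono : Monotone f := by
    refine monotone_nat_of_le_succ fun n => ?_
    induction n with
    | zero => exact bot_le
    | succ n ih => rw [hsucc, hsucc (n + 1)]; exact Φ.monotone ih
  have hle : ∀ n, f n ≤ OrderHom.lfp Φ := by
    intro n
    induction n with
    | zero => exact bot_le
    | succ n ih =>
      rw [hsucc]
      exact (Φ.monotone ih).trans_eq (OrderHom.map_lfp Φ)
  have hfix : Φ (⨆ n, f n) ≤ ⨆ n, f n := by
    intro t x u
    have hrefl : ∀ t x u, reflect b k W e (⨆ n, f n) t x u = ⨆ n, reflect b k W e (f n) t x u := by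
      intro t x u
      simp only [reflect, iSup_apply, ENNReal.mul_iSup]
      refine lintegral_iSup (fun n => ?_) ?_
      · exact ((measurable_reflect_kernel hS hW).comp
          (measurable_const (a := (t, x, u)) |>.prodMk measurable_id)).mul
          ((hmeas n).comp (measurable_const (a := t) |>.prodMk
            (measurable_const (a := x) |>.prodMk measurable_id)))
      · intro m n hmn v
        exact mul_le_mul_right (hmono hmn t x v) _
    have hstep : ∀ n, Φ (f n) t x u ≤ (⨆ n, f n) t x u := fun n => by
      rw [← hsucc]
      simp only [iSup_apply]
      exact le_iSup (fun n => f n t x u) (n + 1)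
    by_cases hne : (precollisionTimes r W t x u).Nonempty
    · have h1 : ∀ g, Φ g t x u = reflect b k W e g (sSup (precollisionTimes r W t x u))
          (x - (t - sSup (precollisionTimes r W t x u)) • u.2) u := fun g => transport_of_nonempty hne
      rw [h1, hrefl]
      refine iSup_le fun n => ?_
      rw [← h1]
      exact hstep n
    · have h1 : ∀ g, Φ g t x u = ENNReal.ofReal (initialDensity a₀ b u) := fun g =>
        transport_of_not_nonempty hne
      rw [h1, ← h1 (f 0)]
      exact hstep 0
  have hlfp : densityBefore r a₀ b k W e = ⨆ n, f n :=
    le_antisymm (OrderHom.lfp_le _ hfix) (iSup_le hle)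
  rw [hlfp]
  have : EndDensity.uncurry (⨆ n, f n) = fun q => ⨆ n, (f n).uncurry q := by
    funext q
    simp only [EndDensity.uncurry, iSup_apply]
  rw [this]
  exact Measurable.iSup hmeas

end Measurability

/-! ### Bounds for the density -/

section Bounds

variable {d : ℕ} {r : ℝ} {W : ℝ → ℝ} {a₀ : ℝ → ℝ} {b : Transverse d → ℝ} {k : ℝ → ℝ → ℝ}
  {e : BodyEnd} {Vinf γs m M G : ℝ} {t : ℝ} {x : Transverse d} {u : Velocity d}

theorem lintegral_b (hS : StructureAssumption a₀ b k) : ∫⁻ y, ENNReal.ofReal (b y) = 1 := by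
  rw [← ofReal_integral_eq_lintegral_ofReal (integrable_b hS)
    (Eventually.of_forall hS.b_nonneg), hS.b_integral, ENNReal.ofReal_one]

theorem lintegral_fst_mul_b (hS : StructureAssumption a₀ b k) {g : ℝ → ℝ≥0∞} (hg : Measurable g) :
    ∫⁻ u : Velocity d, g u.1 * ENNReal.ofReal (b u.2) = ∫⁻ z, g z := by
  have hb := hS.b_continuous
  have := lintegral_prod_mul (μ := (volume : Measure ℝ))
    (ν := (volume : Measure (Transverse d))) hg.aemeasurable
    (hb.measurable.ennreal_ofReal).aemeasurable
  rw [lintegral_b hS, mul_one] at this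
  rw [← this, Measure.volume_eq_prod]

theorem setLIntegral_fst_mul_b (hS : StructureAssumption a₀ b k) {g : ℝ → ℝ≥0∞}
    (hg : Measurable g) {s : Set ℝ} (hs : MeasurableSet s) :
    ∫⁻ u in {u : Velocity d | u.1 ∈ s}, g u.1 * ENNReal.ofReal (b u.2) = ∫⁻ z in s, g z := by
  have hs' : MeasurableSet {u : Velocity d | u.1 ∈ s} := measurable_fst hs
  rw [← lintegral_indicator hs', ← lintegral_indicator hs,
    ← lintegral_fst_mul_b hS (hg.indicator hs)]
  refine lintegral_congr fun u => ?_
  by_cases h : u.1 ∈ s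
  · rw [indicator_of_mem h, indicator_of_mem (show u ∈ {u : Velocity d | u.1 ∈ s} from h)]
  · rw [indicator_of_notMem h, zero_mul,
      indicator_of_notMem (show u ∉ {u : Velocity d | u.1 ∈ s} from h)]

theorem densityBefore_of_not_nonempty (h : ¬(precollisionTimes r W t x u).Nonempty) :
    densityBefore r a₀ b k W e t x u = ENNReal.ofReal (initialDensity a₀ b u) := by
  rw [densityBefore_eq, transport_of_not_nonempty h]

/-- If one reflection does not increase the bound `a₀ + G` on the velocities that can precollide,
then it bounds the density: it gives a supersolution, to be compared with the least solution. -/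
theorem densityBefore_le (hS : StructureAssumption a₀ b k) (hW : Continuous W)
    (hI : ∀ t, W t ∈ Icc m M)
    (hG : ∀ v ∈ Icc m M, ∀ w ∈ Icc m M, ∫⁻ z, ENNReal.ofReal (k (v - w) (z - w)) *
      (ENNReal.ofReal (a₀ z) + (Icc m M).indicator (fun _ => ENNReal.ofReal G) z)
        ≤ ENNReal.ofReal G) :
    densityBefore r a₀ b k W e t x u ≤ (ENNReal.ofReal (a₀ u.1) +
      (Icc m M).indicator (fun _ => ENNReal.ofReal G) u.1) * ENNReal.ofReal (b u.2) := by
  set S : EndDensity d := fun _ _ u => (ENNReal.ofReal (a₀ u.1) +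
      (Icc m M).indicator (fun _ => ENNReal.ofReal G) u.1) * ENNReal.ofReal (b u.2) with hSdef
  have ha := hS.a₀_continuous
  have hk := hS.k_continuous
  suffices h : collisionStep r a₀ b k W e S ≤ S from OrderHom.lfp_le _ h t x u
  intro t x u
  change transport r a₀ b W (reflect b k W e S) t x u ≤ S t x u
  by_cases hne : (precollisionTimes r W t x u).Nonempty
  · rw [transport_of_nonempty hne]
    have hu := fst_mem_of_precollision hW hI hne
    set τ := sSup (precollisionTimes r W t x u)
    have hmeas : Measurable fun z => ENNReal.ofReal (k (u.1 - W τ) (z - W τ)) *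
        (ENNReal.ofReal (a₀ z) + (Icc m M).indicator (fun _ => ENNReal.ofReal G) z) := by
      refine Measurable.mul ?_ (ha.measurable.ennreal_ofReal.add
        (measurable_const.indicator measurableSet_Icc))
      have : Continuous fun z => Function.uncurry k (u.1 - W τ, z - W τ) := by fun_prop
      exact this.measurable.ennreal_ofReal
    calc reflect b k W e S τ (x - (t - τ) • u.2) u
        ≤ ∫⁻ u' : Velocity d, ENNReal.ofReal (b u.2) *
            ((ENNReal.ofReal (k (u.1 - W τ) (u'.1 - W τ)) * (ENNReal.ofReal (a₀ u'.1) +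
              (Icc m M).indicator (fun _ => ENNReal.ofReal G) u'.1)) *
                ENNReal.ofReal (b u'.2)) := by
          refine (setLIntegral_le_lintegral _ _).trans (lintegral_mono fun u' => le_of_eq ?_)
          simp only [collisionKernel, hSdef, ENNReal.ofReal_mul (hS.k_nonneg _ _)]
          ring
      _ = ENNReal.ofReal (b u.2) * ∫⁻ z, ENNReal.ofReal (k (u.1 - W τ) (z - W τ)) *
            (ENNReal.ofReal (a₀ z) + (Icc m M).indicator (fun _ => ENNReal.ofReal G) z) := by
          rw [lintegral_const_mul' _ _ ENNReal.ofReal_ne_top, lintegral_fst_mul_b hS hmeas]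
      _ ≤ ENNReal.ofReal (b u.2) * ENNReal.ofReal G := by
          gcongr
          exact hG _ hu _ (hI τ)
      _ ≤ S t x u := by
          simp only [hSdef, indicator_of_mem hu]
          rw [mul_comm]
          gcongr
          exact le_add_self
  · rw [transport_of_not_nonempty hne, initialDensity, ENNReal.ofReal_mul (hS.a₀_nonneg _)]
    simp only [hSdef]
    gcongr
    exact le_self_add

/-- Particles that precollide at the left end have been hit there by the faster particles of the
undisturbed gas, which bounds the density from below. -/
theorem le_densityBefore_left (hS : StructureAssumption a₀ b k) (hW : Continuous W)
    (hI : ∀ t, W t ∈ Icc m M) {g : ℝ}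
    (hg : ∀ v ∈ Icc m M, ∀ w ∈ Icc m M, ENNReal.ofReal g ≤
      ∫⁻ z in Ioi M, ENNReal.ofReal (k (v - w) (z - w)) * ENNReal.ofReal (a₀ z))
    (hne : (precollisionTimes r W t x u).Nonempty) :
    ENNReal.ofReal (b u.2) * ENNReal.ofReal g
      ≤ densityBefore r a₀ b k W BodyEnd.left t x u := by
  have ha := hS.a₀_continuous
  have hk := hS.k_continuous
  have hu := fst_mem_of_precollision hW hI hne
  rw [densityBefore_eq, transport_of_nonempty hne, densityAfter]
  set τ := sSup (precollisionTimes r W t x u)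
  have hmeas : Measurable fun z => ENNReal.ofReal (k (u.1 - W τ) (z - W τ)) *
      ENNReal.ofReal (a₀ z) := by
    have : Continuous fun z => Function.uncurry k (u.1 - W τ, z - W τ) := by fun_prop
    exact this.measurable.ennreal_ofReal.mul ha.measurable.ennreal_ofReal
  calc ENNReal.ofReal (b u.2) * ENNReal.ofReal g
      ≤ ENNReal.ofReal (b u.2) * ∫⁻ z in Ioi M, ENNReal.ofReal (k (u.1 - W τ) (z - W τ)) *
          ENNReal.ofReal (a₀ z) := by gcongr; exact hg _ hu _ (hI τ)
    _ = ∫⁻ u' in {u' : Velocity d | u'.1 ∈ Ioi M}, ENNReal.ofReal (b u.2) *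
          ((ENNReal.ofReal (k (u.1 - W τ) (u'.1 - W τ)) * ENNReal.ofReal (a₀ u'.1)) *
            ENNReal.ofReal (b u'.2)) := by
        rw [lintegral_const_mul' _ _ ENNReal.ofReal_ne_top,
          setLIntegral_fst_mul_b hS hmeas measurableSet_Ioi]
    _ ≤ ∫⁻ u' in {u' : Velocity d | u'.1 ∈ Ioi M},
          ENNReal.ofReal (collisionKernel k b (u.1 - W τ, u.2) (u'.1 - W τ, u'.2)) *
            densityBefore r a₀ b k W BodyEnd.left τ (x - (t - τ) • u.2) u' := by
        refine setLIntegral_mono' (measurable_fst measurableSet_Ioi) fun u' hu' => le_of_eq ?_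
        have hnot : ¬(precollisionTimes r W τ (x - (t - τ) • u.2) u').Nonempty := fun h =>
          (fst_mem_of_precollision hW hI h).2.not_gt hu'
        rw [densityBefore_of_not_nonempty hnot, initialDensity, collisionKernel,
          ENNReal.ofReal_mul (hS.k_nonneg _ _), ENNReal.ofReal_mul (hS.a₀_nonneg _)]
        ring
    _ ≤ _ := by
        refine lintegral_mono_set fun u' hu' => ?_
        exact (hI τ).2.trans (le_of_lt hu')

/-- The Irreversal Criterion is stable under small perturbations. -/
theorem exists_irreversal_gap (hS : StructureAssumption a₀ b k) (hγs : 0 < γs)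
    (hInt : IntegrabilityAssumption a₀ k Vinf γs) (hIrr : IrreversalCriterion a₀ k Vinf) :
    ∃ ε η₀ : ℝ, 0 < ε ∧ 0 < η₀ ∧ ∀ η, 0 ≤ η → η ≤ η₀ →
      ∀ v ∈ Icc Vinf (Vinf + η), ∀ w ∈ Icc Vinf (Vinf + η), ∀ y ∈ Icc Vinf (Vinf + η),
        ENNReal.ofReal (a₀ y + ε) ≤
        ∫⁻ z in Ioi (Vinf + η), ENNReal.ofReal (k (v - w) (z - w)) * ENNReal.ofReal (a₀ z) := by
  obtain ⟨M, hM, hMb⟩ := hInt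
  have ha := hS.a₀_continuous
  have hk := hS.k_continuous
  set Ψ : ℝ × ℝ × ℝ → ℝ → ℝ := fun q => (Ioi q.2.2).indicator
    fun z => k q.1 (z - q.2.1) * a₀ z with hΨ
  set A := ∫ z in Ioi (0 : ℝ), k 0 z * a₀ (z + Vinf) with hA
  have hcont : ∀ q : ℝ × ℝ × ℝ, Continuous fun z => k q.1 (z - q.2.1) * a₀ z := fun q => by
    have : Continuous fun z => Function.uncurry k (q.1, z - q.2.1) * a₀ z := by fun_prop
    exact this
  have hΨnn : ∀ q z, 0 ≤ Ψ q z := fun q z =>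
    indicator_nonneg (fun z _ => mul_nonneg (hS.k_nonneg _ _) (hS.a₀_nonneg _)) z
  have hΨmeas : ∀ q, AEStronglyMeasurable (Ψ q) := fun q =>
    ((hcont q).measurable.indicator measurableSet_Ioi).aestronglyMeasurable
  have hbound : ∀ q : ℝ × ℝ × ℝ, |q.1| < 2 * γs → |q.2.1 - Vinf| < γs →
      ∀ z, ‖Ψ q z‖ ≤ M z := by
    intro q h1 h2 z
    rw [Real.norm_of_nonneg (hΨnn q z)]
    have := hMb q.1 (q.2.1 - Vinf) z h1 h2
    rw [show z - (q.2.1 - Vinf) - Vinf = z - q.2.1 by ring] at this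
    refine (indicator_le_self' (fun _ _ => mul_nonneg (hS.k_nonneg _ _) (hS.a₀_nonneg _)) z).trans
      this
  have hev : ∀ᶠ q in 𝓝 ((0, Vinf, Vinf) : ℝ × ℝ × ℝ),
      |q.1| < 2 * γs ∧ |q.2.1 - Vinf| < γs := by
    have h1 : Continuous fun q : ℝ × ℝ × ℝ => |q.1| := by fun_prop
    have h2 : Continuous fun q : ℝ × ℝ × ℝ => |q.2.1 - Vinf| := by fun_prop
    refine Filter.Eventually.and (h1.continuousAt.eventually_lt continuousAt_const ?_)
      (h2.continuousAt.eventually_lt continuousAt_const ?_)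
    · simpa using hγs
    · simpa using hγs
  have hlim : Tendsto (fun q => ∫ z, Ψ q z) (𝓝 (0, Vinf, Vinf)) (𝓝 (∫ z, Ψ (0, Vinf, Vinf) z)) := by
    refine tendsto_integral_filter_of_dominated_convergence M (Eventually.of_forall hΨmeas)
      ?_ hM ?_
    · filter_upwards [hev] with q hq
      exact Eventually.of_forall (hbound q hq.1 hq.2)
    · have hne : ∀ᵐ z : ℝ, z ≠ Vinf := by simp [ae_iff]
      filter_upwards [hne] with z hz
      have hc : ContinuousAt (fun q : ℝ × ℝ × ℝ => k q.1 (z - q.2.1) * a₀ z) (0, Vinf, Vinf) := by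
        have : Continuous fun q : ℝ × ℝ × ℝ => Function.uncurry k (q.1, z - q.2.1) * a₀ z := by
          fun_prop
        exact this.continuousAt
      rcases lt_or_gt_of_ne hz with h | h
      · have h0 : Ψ (0, Vinf, Vinf) z = 0 := indicator_of_notMem (by simpa using h.le) _
        rw [h0]
        refine tendsto_const_nhds.congr' ?_
        filter_upwards [(isOpen_lt continuous_const continuous_snd.snd).mem_nhds
          (show z < ((0, Vinf, Vinf) : ℝ × ℝ × ℝ).2.2 from h)] with q hq
        exact (indicator_of_notMem (not_lt.2 (le_of_lt hq)) _).symm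
      · have h0 : Ψ (0, Vinf, Vinf) z = k 0 (z - Vinf) * a₀ z := indicator_of_mem h _
        rw [h0]
        refine Tendsto.congr' ?_ hc
        filter_upwards [(isOpen_lt continuous_snd.snd continuous_const).mem_nhds
          (show ((0, Vinf, Vinf) : ℝ × ℝ × ℝ).2.2 < z from h)] with q hq
        exact (indicator_of_mem (s := Ioi q.2.2) hq fun z => k q.1 (z - q.2.1) * a₀ z).symm
  have hval : ∫ z, Ψ (0, Vinf, Vinf) z = A := by
    simp only [hΨ, hA]
    rw [← integral_indicator measurableSet_Ioi, integral_indicator measurableSet_Ioi,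
      ← integral_indicator measurableSet_Ioi,
      ← integral_add_right_eq_self _ Vinf]
    refine integral_congr_ae (Eventually.of_forall fun z => ?_)
    by_cases hz : 0 < z
    · simp [indicator, hz]
    · simp [indicator, hz]
  have hgap : 0 < A - a₀ Vinf := sub_pos.2 hIrr
  rw [hval] at hlim
  set ε := (A - a₀ Vinf) / 4 with hε
  have h1 := hlim.eventually (lt_mem_nhds (show A - ε < A by linarith))
  obtain ⟨δ₁, hδ₁, hδ₁b⟩ := Metric.eventually_nhds_iff.1 (h1.and hev)
  obtain ⟨δ₂, hδ₂, hδ₂b⟩ := Metric.continuous_iff.1 ha Vinf ε (by positivity)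
  refine ⟨ε, min (δ₁ / 2) (δ₂ / 2), by positivity, by positivity, ?_⟩
  intro η hη0 hη v hv w hw y hy
  have hη1 : η < δ₁ := (hη.trans (min_le_left _ _)).trans_lt (by linarith)
  have hη2 : η < δ₂ := (hη.trans (min_le_right _ _)).trans_lt (by linarith)
  have hq : dist ((v - w, w, Vinf + η) : ℝ × ℝ × ℝ) (0, Vinf, Vinf) < δ₁ := by
    rw [Prod.dist_eq, Prod.dist_eq, Real.dist_eq, Real.dist_eq, Real.dist_eq]
    refine max_lt ?_ (max_lt ?_ ?_) <;> rw [abs_lt] <;> constructor <;>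
      simp only <;> linarith [hv.1, hv.2, hw.1, hw.2]
  obtain ⟨h2, h3, h4⟩ := hδ₁b hq
  have h5 : a₀ y ≤ a₀ Vinf + ε := by
    have := hδ₂b y (by
      rw [Real.dist_eq, abs_lt]; constructor <;> linarith [hy.1, hy.2])
    rw [Real.dist_eq, abs_lt] at this
    linarith [this.2]
  have hintΨ : Integrable (Ψ (v - w, w, Vinf + η)) :=
    hM.mono' (hΨmeas _) (Eventually.of_forall (hbound _ h3 h4))
  calc ENNReal.ofReal (a₀ y + ε) ≤ ENNReal.ofReal (∫ z, Ψ (v - w, w, Vinf + η) z) := by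
        refine ENNReal.ofReal_le_ofReal ?_
        linarith
    _ = ∫⁻ z, ENNReal.ofReal (Ψ (v - w, w, Vinf + η) z) :=
        ofReal_integral_eq_lintegral_ofReal hintΨ (Eventually.of_forall (hΨnn _))
    _ = ∫⁻ z in Ioi (Vinf + η), ENNReal.ofReal (k (v - w) (z - w)) * ENNReal.ofReal (a₀ z) := by
        rw [← lintegral_indicator measurableSet_Ioi]
        refine lintegral_congr fun z => ?_
        by_cases hz : z ∈ Ioi (Vinf + η)
        · rw [hΨ]
          simp only
          rw [indicator_of_mem hz, indicator_of_mem hz, ENNReal.ofReal_mul (hS.k_nonneg _ _)]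
        · rw [hΨ]
          simp only
          rw [indicator_of_notMem hz, indicator_of_notMem hz, ENNReal.ofReal_zero]

/-- Once the velocities that can precollide fill a sufficiently short interval, a reflection is a
contraction on them, because `k` is bounded for small incoming relative velocities. -/
theorem exists_density_majorant (hS : StructureAssumption a₀ b k) (hγs : 0 < γs)
    (hBdd : BoundednessAssumption k γs) (hInt : IntegrabilityAssumption a₀ k Vinf γs) :
    ∃ G η₀ : ℝ, 0 < G ∧ 0 < η₀ ∧ ∀ η, 0 ≤ η → η ≤ η₀ →
      ∀ v ∈ Icc Vinf (Vinf + η), ∀ w ∈ Icc Vinf (Vinf + η),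
        ∫⁻ z, ENNReal.ofReal (k (v - w) (z - w)) * (ENNReal.ofReal (a₀ z) +
          (Icc Vinf (Vinf + η)).indicator (fun _ => ENNReal.ofReal G) z) ≤ ENNReal.ofReal G := by
  obtain ⟨M, hM, hMb⟩ := hInt
  obtain ⟨B, hB⟩ := hBdd
  have ha := hS.a₀_continuous
  have hk := hS.k_continuous
  have hB0 : 0 ≤ B := (hS.k_nonneg 0 0).trans (hB 0 0 (by simpa using hγs.le))
  have hM0 : ∀ z, 0 ≤ M z := fun z => by
    have := hMb 0 0 z (by simpa using hγs) (by simpa using hγs)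
    exact (mul_nonneg (hS.k_nonneg _ _) (hS.a₀_nonneg _)).trans this
  have hIM : 0 ≤ ∫ z, M z := integral_nonneg hM0
  set G := 2 * (∫ z, M z) + 1 with hG
  refine ⟨G, min (γs / 2) (1 / (2 * (B + 1))), by positivity, by positivity, ?_⟩
  intro η hη0 hη v hv w hw
  have hη1 : η < γs := (hη.trans (min_le_left _ _)).trans_lt (by linarith)
  have hη2 : B * η ≤ 1 / 2 := by
    have h1 := hη.trans (min_le_right _ _)
    rw [le_div_iff₀ (by positivity)] at h1
    nlinarith
  have hkm : Measurable fun z => ENNReal.ofReal (k (v - w) (z - w)) := by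
    have : Continuous fun z => Function.uncurry k (v - w, z - w) := by fun_prop
    exact this.measurable.ennreal_ofReal
  simp only [mul_add]
  have hm : Measurable fun z => ENNReal.ofReal (k (v - w) (z - w)) * ENNReal.ofReal (a₀ z) :=
    hkm.mul ha.measurable.ennreal_ofReal
  rw [lintegral_add_left hm]
  have h1 : ∫⁻ z, ENNReal.ofReal (k (v - w) (z - w)) * ENNReal.ofReal (a₀ z)
      ≤ ENNReal.ofReal (∫ z, M z) := by
    rw [ofReal_integral_eq_lintegral_ofReal hM (Eventually.of_forall hM0)]
    refine lintegral_mono fun z => ?_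
    rw [← ENNReal.ofReal_mul (hS.k_nonneg _ _)]
    refine ENNReal.ofReal_le_ofReal ?_
    have := hMb (v - w) (w - Vinf) z
      (by rw [abs_lt]; constructor <;> linarith [hv.1, hv.2, hw.1, hw.2])
      (by rw [abs_lt]; constructor <;> linarith [hw.1, hw.2])
    rwa [show z - (w - Vinf) - Vinf = z - w by ring] at this
  have h2 : ∫⁻ z, ENNReal.ofReal (k (v - w) (z - w)) *
      (Icc Vinf (Vinf + η)).indicator (fun _ => ENNReal.ofReal G) z
        ≤ ENNReal.ofReal (B * G * η) := by
    calc _ ≤ ∫⁻ z, (Icc Vinf (Vinf + η)).indicator (fun _ => ENNReal.ofReal (B * G)) z := by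
          refine lintegral_mono fun z => ?_
          by_cases hz : z ∈ Icc Vinf (Vinf + η)
          · simp only [indicator_of_mem hz]
            rw [← ENNReal.ofReal_mul (hS.k_nonneg _ _)]
            refine ENNReal.ofReal_le_ofReal (mul_le_mul_of_nonneg_right (hB _ _ ?_) (by positivity))
            rw [abs_le]; constructor <;> linarith [hz.1, hz.2, hw.1, hw.2]
          · simp only [indicator_of_notMem hz, mul_zero, le_refl]
      _ = ENNReal.ofReal (B * G * η) := by
          rw [lintegral_indicator measurableSet_Icc, setLIntegral_const, Real.volume_Icc,
            ← ENNReal.ofReal_mul (by positivity)]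
          congr 1
          ring
  calc _ ≤ ENNReal.ofReal (∫ z, M z) + ENNReal.ofReal (B * G * η) := add_le_add h1 h2
    _ = ENNReal.ofReal ((∫ z, M z) + B * G * η) :=
        (ENNReal.ofReal_add hIM (by positivity)).symm
    _ ≤ ENNReal.ofReal G := by
        refine ENNReal.ofReal_le_ofReal ?_
        have : B * η * G ≤ 1 / 2 * G := mul_le_mul_of_nonneg_right hη2 (by positivity)
        linarith

/-- The change `f_- - f₀` of the density that is caused by precollisions. -/
noncomputable def densityChange {d : ℕ} (r : ℝ) (a₀ : ℝ → ℝ) (b : Transverse d → ℝ)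
    (k : ℝ → ℝ → ℝ) (W : ℝ → ℝ) (e : BodyEnd) (t : ℝ) (x : Transverse d) (u : Velocity d) : ℝ :=
  (densityBefore r a₀ b k W e t x u).toReal - initialDensity a₀ b u

theorem densityChange_eq_zero (hS : StructureAssumption a₀ b k)
    (h : ¬(precollisionTimes r W t x u).Nonempty) : densityChange r a₀ b k W e t x u = 0 := by
  rw [densityChange, densityBefore_of_not_nonempty h, ENNReal.toReal_ofReal, sub_self]
  exact mul_nonneg (hS.a₀_nonneg _) (hS.b_nonneg _)

theorem exists_a₀_le (hS : StructureAssumption a₀ b k) : ∃ A, 0 < A ∧ ∀ u, a₀ u ≤ A := by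
  obtain ⟨B, hB⟩ := hS.f₀_bounded
  refine ⟨|B| / b 0 + 1, by have := hS.b_zero_pos; positivity, fun u => ?_⟩
  have h := hB (u, 0)
  rw [initialDensity, ← le_div_iff₀ hS.b_zero_pos] at h
  have : B / b 0 ≤ |B| / b 0 := by
    have := hS.b_zero_pos
    gcongr
    exact le_abs_self B
  simp only at h
  linarith

/-- The density changes by an amount comparable with `b(u_⊥)`, and at the left end precollisions
strictly increase it. -/
theorem exists_densityChange_bounds (hS : StructureAssumption a₀ b k) (hγs : 0 < γs)
    (hBdd : BoundednessAssumption k γs) (hInt : IntegrabilityAssumption a₀ k Vinf γs)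
    (hIrr : IrreversalCriterion a₀ k Vinf) :
    ∃ G ε η₀ : ℝ, 0 < G ∧ 0 < ε ∧ 0 < η₀ ∧ ∀ η, 0 ≤ η → η ≤ η₀ → ∀ (r : ℝ) (W : ℝ → ℝ),
      Continuous W → (∀ t, W t ∈ Icc Vinf (Vinf + η)) → ∀ t x (u : Velocity d),
        (∀ e, densityBefore r a₀ b k W e t x u < ∞) ∧
        (∀ e, |densityChange r a₀ b k W e t x u| ≤ G * b u.2) ∧
        ((precollisionTimes r W t x u).Nonempty →
          ε * b u.2 ≤ densityChange r a₀ b k W BodyEnd.left t x u) := by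
  obtain ⟨A, hA0, hA⟩ := exists_a₀_le hS
  obtain ⟨ε, η₁, hε, hη₁, hgap⟩ := exists_irreversal_gap hS hγs hInt hIrr
  obtain ⟨G, η₂, hG, hη₂, hmaj⟩ := exists_density_majorant hS hγs hBdd hInt
  refine ⟨A + G, ε, min η₁ η₂, by positivity, hε, by positivity, ?_⟩
  intro η hη0 hη r W hW hI t x u
  have hb := hS.b_nonneg u.2
  have hf0 : 0 ≤ initialDensity a₀ b u := mul_nonneg (hS.a₀_nonneg _) hb
  have hle : ∀ e, densityBefore r a₀ b k W e t x u
      ≤ ENNReal.ofReal (initialDensity a₀ b u + G * b u.2) := by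
    intro e
    refine (densityBefore_le hS hW hI (hmaj η hη0 (hη.trans (min_le_right _ _)))).trans ?_
    rw [initialDensity, ← add_mul, ENNReal.ofReal_mul (add_nonneg (hS.a₀_nonneg _) hG.le),
      ENNReal.ofReal_add (hS.a₀_nonneg _) hG.le]
    gcongr
    exact indicator_le_self _ (fun _ => ENNReal.ofReal G) _
  have hfin : ∀ e, densityBefore r a₀ b k W e t x u < ∞ := fun e =>
    (hle e).trans_lt ENNReal.ofReal_lt_top
  refine ⟨hfin, fun e => ?_, fun hne => ?_⟩
  · have h1 : (densityBefore r a₀ b k W e t x u).toReal ≤ initialDensity a₀ b u + G * b u.2 :=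
      ENNReal.toReal_le_of_le_ofReal (by positivity) (hle e)
    have h2 : 0 ≤ (densityBefore r a₀ b k W e t x u).toReal := ENNReal.toReal_nonneg
    have h3 : initialDensity a₀ b u ≤ A * b u.2 := mul_le_mul_of_nonneg_right (hA _) hb
    have h4 : 0 ≤ G * b u.2 := by positivity
    rw [densityChange, abs_le, add_mul]
    constructor <;> linarith
  · have hu := fst_mem_of_precollision hW hI hne
    have h1 := le_densityBefore_left (r := r) (t := t) (x := x) (u := u) hS hW hI
      (fun v hv w hw => hgap η hη0 (hη.trans (min_le_left _ _)) v hv w hw u.1 hu) hne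
    rw [← ENNReal.ofReal_mul hb] at h1
    have h2 := (ENNReal.ofReal_le_iff_le_toReal (hfin _).ne).1 h1
    rw [densityChange, initialDensity]
    linarith

end Bounds

/-! ### Motions that decay to `V_∞` -/

section Motion

/-- The bounds shared by all motions of the class `𝒲`, for a motion extended continuously to
negative times: `W - V_∞` lies between `γ e^{-Kt}` and `γ e^{-βt} + α ⟨t⟩^{-N}`. -/
structure DecayingMotion (Vinf γ α β K N : ℝ) (W : ℝ → ℝ) : Prop where
  continuous : Continuous W
  range : ∀ t, W t ∈ Icc Vinf (Vinf + (γ + α))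
  lower : ∀ t, 0 ≤ t → γ * Real.exp (-K * t) ≤ W t - Vinf
  upper : ∀ t, 0 ≤ t → W t - Vinf ≤ γ * Real.exp (-β * t) + α / (1 + t) ^ N

theorem IsAdmissibleMotion.decayingMotion {d : ℕ} {r : ℝ} {a₀ : ℝ → ℝ} {b : Transverse d → ℝ}
    {k : ℝ → ℝ → ℝ} {Vinf p Aplus Aminus γ β K : ℝ} {W : ℝ → ℝ}
    (hW : IsAdmissibleMotion r a₀ b k Vinf p Aplus Aminus γ W) (hp : 0 < p) (hγ : 0 < γ)
    (hAp : 0 < Aplus) (hAm : 0 < Aminus) (hβ : 0 < β)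
    (hmin : β ≤ rateMin r a₀ b k Vinf γ) (hmax : rateMax r a₀ b k Vinf γ ≤ K) :
    DecayingMotion Vinf γ (γ ^ (p + 1) * Aminus) β K (p + d) (fun t => W (max t 0)) := by
  have hγp : γ ^ (p + 1) = γ * γ ^ p := by
    rw [Real.rpow_add hγ, Real.rpow_one, mul_comm]
  have hlow : ∀ t, 0 ≤ t → γ * Real.exp (-K * t) ≤ W t - Vinf := by
    intro t ht
    have h := hW.upper t ht
    have h1 : Real.exp (-K * t) ≤ Real.exp (-rateMax r a₀ b k Vinf γ * t) := by
      gcongr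
    have h2 : 0 ≤ (if startTime γ + 1 ≤ t then γ ^ p * Aplus / t ^ (p + (d : ℝ)) else 0) := by
      split_ifs <;> positivity
    rw [gFun] at h
    nlinarith
  have hup : ∀ t, 0 ≤ t →
      W t - Vinf ≤ γ * Real.exp (-β * t) + γ ^ (p + 1) * Aminus / (1 + t) ^ (p + (d : ℝ)) := by
    intro t ht
    have h := hW.lower t ht
    have h1 : Real.exp (-rateMin r a₀ b k Vinf γ * t) ≤ Real.exp (-β * t) := by
      gcongr
    rw [hFun, bracket] at h
    rw [hγp]
    have h3 : γ * γ ^ p * Aminus / (1 + t) ^ (p + (d : ℝ))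
        = γ * (γ ^ p * Aminus / (1 + t) ^ (p + (d : ℝ))) := by ring
    rw [h3]
    nlinarith
  refine ⟨?_, ?_, ?_, ?_⟩
  · obtain ⟨L, hL⟩ := hW.lipschitz
    exact hL.continuousOn.comp_continuous (by fun_prop) fun t => mem_Ici.2 (le_max_right _ _)
  · intro t
    have h0 : 0 ≤ max t 0 := le_max_right _ _
    have h1 := hlow _ h0
    have h2 := hup _ h0
    have h3 : 0 ≤ γ * Real.exp (-K * max t 0) := by positivity
    have h4 : Real.exp (-β * max t 0) ≤ 1 := by
      rw [Real.exp_le_one_iff]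
      nlinarith
    have h5 : γ ^ (p + 1) * Aminus / (1 + max t 0) ^ (p + (d : ℝ)) ≤ γ ^ (p + 1) * Aminus :=
      div_le_self (by positivity) (Real.one_le_rpow (by linarith) (by positivity))
    constructor
    · linarith
    · nlinarith
  · intro t ht
    simpa [max_eq_left ht] using hlow t ht
  · intro t ht
    simpa [max_eq_left ht] using hup t ht

/-- Exponentials decay faster than powers. -/
theorem exists_exp_le_rpow {a q : ℝ} (ha : 0 < a) (hq : 0 < q) :
    ∃ C : ℝ, 0 < C ∧ ∀ t, 0 ≤ t → Real.exp (-a * t) ≤ C / (1 + t) ^ q := by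
  set m := a / q with hm
  have hm0 : 0 < m := by positivity
  refine ⟨(max 1 (1 / m)) ^ q, by positivity, fun t ht => ?_⟩
  rw [le_div_iff₀ (by positivity)]
  have h1 : 1 + t ≤ max 1 (1 / m) * Real.exp (m * t) := by
    have h2 : m * t + 1 ≤ Real.exp (m * t) := Real.add_one_le_exp _
    calc 1 + t = 1 * 1 + (1 / m) * (m * t) := by field_simp
      _ ≤ max 1 (1 / m) * 1 + max 1 (1 / m) * (m * t) := by
          gcongr
          · exact le_max_left _ _
          · exact le_max_right _ _
      _ = max 1 (1 / m) * (m * t + 1) := by ring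
      _ ≤ _ := by gcongr
  have h3 : (1 + t) ^ q ≤ (max 1 (1 / m)) ^ q * Real.exp (a * t) := by
    calc (1 + t) ^ q ≤ (max 1 (1 / m) * Real.exp (m * t)) ^ q := by gcongr
      _ = (max 1 (1 / m)) ^ q * Real.exp (a * t) := by
          rw [Real.mul_rpow (by positivity) (by positivity), ← Real.exp_mul]
          congr 2
          rw [hm]
          field_simp
  calc Real.exp (-a * t) * (1 + t) ^ q
      ≤ Real.exp (-a * t) * ((max 1 (1 / m)) ^ q * Real.exp (a * t)) := by gcongr
    _ = (max 1 (1 / m)) ^ q * (Real.exp (-a * t) * Real.exp (a * t)) := by ring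
    _ = (max 1 (1 / m)) ^ q := by rw [← Real.exp_add]; simp

variable {Vinf γ α β K N : ℝ} {W : ℝ → ℝ}

theorem DecayingMotion.integral_sub_le (h : DecayingMotion Vinf γ α β K N W) (hγ : 0 < γ)
    (hα : 0 < α) (hβ : 0 < β) (hN : 1 < N) {t : ℝ} (ht : 0 ≤ t) :
    ∫ σ in 0..t, (W σ - Vinf) ≤ (1 / β + 1 / (N - 1)) * (γ + α) := by
  have hc := h.continuous
  set H : ℝ → ℝ := fun σ => -(γ / β) * Real.exp (-β * σ) - α / (N - 1) * (1 + σ) ^ (-(N - 1))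
    with hH
  have hN' : N - 1 ≠ 0 := by linarith
  have hd : ∀ σ ∈ uIcc 0 t, HasDerivAt H (γ * Real.exp (-β * σ) + α / (1 + σ) ^ N) σ := by
    intro σ hσ
    rw [uIcc_of_le ht] at hσ
    have hpos : 0 < 1 + σ := by linarith [hσ.1]
    have h1 : HasDerivAt (fun σ : ℝ => Real.exp (-β * σ)) (Real.exp (-β * σ) * (-β)) σ := by
      simpa using ((hasDerivAt_id σ).const_mul (-β)).exp
    have h2 : HasDerivAt (fun σ : ℝ => (1 + σ) ^ (-(N - 1)))
        (1 * (-(N - 1)) * (1 + σ) ^ (-(N - 1) - 1)) σ :=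
      ((hasDerivAt_id σ).const_add 1).rpow_const (Or.inl hpos.ne')
    refine ((h1.const_mul (-(γ / β))).sub (h2.const_mul (α / (N - 1)))).congr_deriv ?_
    rw [show -(N - 1) - 1 = -N by ring, Real.rpow_neg hpos.le]
    field_simp
    ring
  have hcont : ContinuousOn (fun σ => γ * Real.exp (-β * σ) + α / (1 + σ) ^ N) (uIcc 0 t) := by
    rw [uIcc_of_le ht]
    refine ContinuousOn.add (by fun_prop) (ContinuousOn.div continuousOn_const ?_ ?_)
    · exact ContinuousOn.rpow_const (by fun_prop) fun σ hσ => Or.inl (by linarith [hσ.1])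
    · intro σ hσ
      have : 0 < 1 + σ := by linarith [hσ.1]
      positivity
  have hi := hcont.intervalIntegrable (μ := volume)
  calc ∫ σ in 0..t, (W σ - Vinf)
      ≤ ∫ σ in 0..t, (γ * Real.exp (-β * σ) + α / (1 + σ) ^ N) :=
        intervalIntegral.integral_mono_on ht
          ((hc.sub continuous_const).intervalIntegrable _ _) hi fun σ hσ => h.upper σ hσ.1
    _ = H t - H 0 := intervalIntegral.integral_eq_sub_of_hasDerivAt hd hi
    _ ≤ γ / β + α / (N - 1) := by
        have hN0 : 0 < N - 1 := by linarith
        have h1 : 0 ≤ γ / β * Real.exp (-β * t) := by positivity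
        have h2 : 0 ≤ α / (N - 1) * (1 + t) ^ (-(N - 1)) := by positivity
        simp only [hH, mul_zero, Real.exp_zero, add_zero, Real.one_rpow]
        linarith
    _ ≤ (1 / β + 1 / (N - 1)) * (γ + α) := by
        have hN0 : 0 < N - 1 := by linarith
        have h1 : 0 ≤ α / β := by positivity
        have h2 : 0 ≤ γ / (N - 1) := by positivity
        have : (1 / β + 1 / (N - 1)) * (γ + α) = γ / β + α / (N - 1) + α / β + γ / (N - 1) := by
          ring
        linarith

theorem timeAverage_sub_const (hc : Continuous W) {s t : ℝ} (hst : s < t) :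
    (t - s) * (timeAverage W s t - Vinf) = ∫ σ in s..t, (W σ - Vinf) := by
  rw [intervalIntegral.integral_sub (hc.intervalIntegrable _ _) (by simp),
    intervalIntegral.integral_const, smul_eq_mul, timeAverage]
  have : t - s ≠ 0 := (sub_pos.2 hst).ne'
  field_simp

/-- Averages over intervals that fill at least half of `[0, t]` deviate from `V_∞` by
`O((γ + α)/t)`. -/
theorem DecayingMotion.timeAverage_le_of_le_half (h : DecayingMotion Vinf γ α β K N W)
    (hγ : 0 < γ) (hα : 0 < α) (hβ : 0 < β) (hN : 1 < N) {s t : ℝ} (hs : 0 < s) (hst : s < t)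
    (hs2 : s ≤ t / 2) :
    timeAverage W s t - Vinf ≤ 2 * (1 / β + 1 / (N - 1)) * (γ + α) / t := by
  have hc := h.continuous
  have ht : 0 < t := hs.trans hst
  have h1 : ∫ σ in s..t, (W σ - Vinf) ≤ ∫ σ in 0..t, (W σ - Vinf) := by
    refine intervalIntegral.integral_mono_interval hs.le hst.le le_rfl
      (Eventually.of_forall fun σ => sub_nonneg.2 (h.range σ).1)
      ((hc.sub continuous_const).intervalIntegrable _ _)
  have h2 := h1.trans (h.integral_sub_le hγ hα hβ hN ht.le)
  rw [← timeAverage_sub_const hc hst] at h2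
  have h3 : 0 ≤ timeAverage W s t - Vinf :=
    sub_nonneg.2 (le_timeAverage hst hc fun σ _ => (h.range σ).1)
  rw [le_div_iff₀ ht]
  nlinarith

theorem DecayingMotion.sub_le_div (h : DecayingMotion Vinf γ α β K N W)
    (hγ : 0 < γ) (hα : 0 < α) (hβ : 0 < β) (hN : 1 < N) {t : ℝ} (ht : 0 < t) :
    W t - Vinf ≤ (1 / β + 1) * (γ + α) / t := by
  have h1 : Real.exp (-β * t) ≤ 1 / β / t := by
    have := Real.add_one_le_exp (β * t)
    rw [neg_mul, Real.exp_neg, div_div, one_div]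
    gcongr
    linarith
  have h2 : α / (1 + t) ^ N ≤ α / t := by
    gcongr
    calc t ≤ 1 + t := by linarith
      _ ≤ (1 + t) ^ N := Real.self_le_rpow_of_one_le (by linarith) hN.le
  calc W t - Vinf ≤ γ * Real.exp (-β * t) + α / (1 + t) ^ N := h.upper t ht.le
    _ ≤ γ * (1 / β / t) + α / t := by gcongr
    _ = (1 / β * γ + α) / t := by ring
    _ ≤ (1 / β + 1) * (γ + α) / t := by
        gcongr
        have : 0 ≤ 1 / β * α := by positivity
        nlinarith

/-- On the second half of `[0, t]` the motion deviates from `V_∞` by `O((γ + α)⟨t⟩^{-N})`. -/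
theorem exists_sub_le_of_half_le (hβ : 0 < β) (hN : 1 < N) :
    ∃ C : ℝ, 0 < C ∧ ∀ {Vinf γ α K : ℝ} {W : ℝ → ℝ}, DecayingMotion Vinf γ α β K N W → 0 < γ →
      0 < α → ∀ σ t, 0 ≤ t → t / 2 ≤ σ → W σ - Vinf ≤ C * (γ + α) / (1 + t) ^ N := by
  obtain ⟨C, hC, hexp⟩ := exists_exp_le_rpow (a := β / 2) (q := N) (by positivity) (by linarith)
  refine ⟨C + 2 ^ N, by positivity, fun {Vinf γ α K W} h hγ hα σ t ht hσ => ?_⟩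
  have h1 : Real.exp (-β * σ) ≤ C / (1 + t) ^ N := by
    refine le_trans (Real.exp_le_exp.2 ?_) (hexp t ht)
    nlinarith
  have h2 : α / (1 + σ) ^ N ≤ 2 ^ N * α / (1 + t) ^ N := by
    rw [div_le_div_iff₀ (by have : 0 < 1 + σ := by linarith
                            positivity) (by positivity)]
    calc α * (1 + t) ^ N ≤ α * (2 * (1 + σ)) ^ N := by
          gcongr
          linarith
      _ = 2 ^ N * α * (1 + σ) ^ N := by
          rw [Real.mul_rpow (by norm_num) (by linarith)]
          ring
  calc W σ - Vinf ≤ γ * Real.exp (-β * σ) + α / (1 + σ) ^ N := h.upper σ (by linarith)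
    _ ≤ γ * (C / (1 + t) ^ N) + 2 ^ N * α / (1 + t) ^ N := by gcongr
    _ = (C * γ + 2 ^ N * α) / (1 + t) ^ N := by ring
    _ ≤ (C + 2 ^ N) * (γ + α) / (1 + t) ^ N := by
        gcongr
        have h3 : 0 ≤ C * α := by positivity
        have h4 : (0 : ℝ) ≤ 2 ^ N * γ := by positivity
        nlinarith

/-- Every velocity strictly between `W(t)` and `V_∞ + γ e^{-K}/t`, which is less than the average
of the motion, is attained as an average `⟨W⟩_{s,t}`, so that slow transverse motion leads to a
precollision. -/
theorem DecayingMotion.nonempty_precollisionTimes {d : ℕ} {r : ℝ}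
    (h : DecayingMotion Vinf γ α β K N W) (hγ : 0 < γ) (hK : 0 ≤ K) {t : ℝ} (ht : 1 ≤ t)
    {x : Transverse d} (hx : ‖x‖ ≤ r / 2) {u : Velocity d} (hu2 : ‖u.2‖ ≤ r / (2 * t))
    (hlow : W t < u.1) (hup : u.1 < Vinf + γ * Real.exp (-K) / t) :
    (precollisionTimes r W t x u).Nonempty := by
  have hc := h.continuous
  have ht0 : 0 < t := by linarith
  set φ : ℝ → ℝ := fun s => ∫ σ in s..t, (W σ - u.1) with hφ
  have hi : ∀ a b, IntervalIntegrable (fun σ => W σ - u.1) volume a b := fun a b =>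
    (hc.sub continuous_const).intervalIntegrable _ _
  have hφc : Continuous φ := by
    have : φ = fun s => -∫ σ in t..s, (W σ - u.1) := by
      funext s; exact intervalIntegral.integral_symm _ _
    rw [this]
    exact (intervalIntegral.continuous_primitive hi t).neg
  -- the integral over `[0, 1]` alone makes the average over `[0, t]` large
  have hφ0 : 0 < φ 0 := by
    have h1 : ∫ _ in (0 : ℝ)..1, γ * Real.exp (-K) ≤ ∫ σ in (0 : ℝ)..1, (W σ - Vinf) := by
      refine intervalIntegral.integral_mono_on zero_le_one (by simp)
        ((hc.sub continuous_const).intervalIntegrable _ _) fun σ hσ => ?_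
      refine le_trans ?_ (h.lower σ hσ.1)
      gcongr
      nlinarith [hσ.2]
    have h2 : ∫ σ in (0 : ℝ)..1, (W σ - Vinf) ≤ ∫ σ in 0..t, (W σ - Vinf) :=
      intervalIntegral.integral_mono_interval le_rfl zero_le_one ht
        (Eventually.of_forall fun σ => sub_nonneg.2 (h.range σ).1)
        ((hc.sub continuous_const).intervalIntegrable _ _)
    have h3 : φ 0 = (∫ σ in 0..t, (W σ - Vinf)) - t * (u.1 - Vinf) := by
      simp only [hφ]
      rw [intervalIntegral.integral_sub (hc.intervalIntegrable _ _) (by simp),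
        intervalIntegral.integral_sub (hc.intervalIntegrable _ _) (by simp)]
      simp only [intervalIntegral.integral_const, smul_eq_mul]
      ring
    rw [intervalIntegral.integral_const, smul_eq_mul] at h1
    have h4 : t * (u.1 - Vinf) < γ * Real.exp (-K) := by
      have h5 : u.1 - Vinf < γ * Real.exp (-K) / t := by linarith
      rw [lt_div_iff₀ ht0] at h5
      linarith
    rw [h3]
    linarith
  -- close to `t` the body is slower than the particle
  obtain ⟨s', hs'0, hs't, hs'⟩ : ∃ s', 0 < s' ∧ s' < t ∧ φ s' < 0 := by
    have hnhds : ∀ᶠ σ in 𝓝 t, W σ < u.1 := hc.continuousAt.eventually_lt continuousAt_const hlow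
    obtain ⟨δ, hδ, hδb⟩ := Metric.eventually_nhds_iff.1 hnhds
    refine ⟨max (t / 2) (t - δ / 2), lt_max_of_lt_left (by linarith),
      max_lt (by linarith) (by linarith), ?_⟩
    set s' := max (t / 2) (t - δ / 2)
    have hs't : s' < t := max_lt (by linarith) (by linarith)
    have hneg : 0 < ∫ σ in s'..t, (u.1 - W σ) := by
      refine intervalIntegral.intervalIntegral_pos_of_pos_on
        ((continuous_const.sub hc).intervalIntegrable _ _) (fun σ hσ => sub_pos.2 (hδb ?_)) hs't
      have : t - δ / 2 ≤ s' := le_max_right _ _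
      rw [Real.dist_eq, abs_lt]
      constructor <;> linarith [hσ.1, hσ.2]
    have heq : φ s' = -∫ σ in s'..t, (u.1 - W σ) := by
      rw [← intervalIntegral.integral_neg]
      simp only [hφ, neg_sub]
    rw [heq]
    linarith
  obtain ⟨s, hs, hs0⟩ := intermediate_value_Ioo' hs'0.le hφc.continuousOn
    (show (0 : ℝ) ∈ Ioo (φ s') (φ 0) from ⟨hs', hφ0⟩)
  have hst : s < t := hs.2.trans hs't
  refine ⟨s, hs.1, hst, ?_, ?_⟩
  · have h1 := timeAverage_sub_const (Vinf := u.1) hc hst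
    rw [show ∫ σ in s..t, (W σ - u.1) = 0 from hs0, mul_eq_zero] at h1
    rcases h1 with h1 | h1 <;> linarith
  · rw [crossSection, mem_closedBall_zero_iff]
    calc ‖x - (t - s) • u.2‖ ≤ ‖x‖ + ‖(t - s) • u.2‖ := norm_sub_le _ _
      _ = ‖x‖ + (t - s) * ‖u.2‖ := by
          rw [norm_smul, Real.norm_of_nonneg (by linarith)]
      _ ≤ r / 2 + t * (r / (2 * t)) := by
          have := norm_nonneg u.2
          have := hs.1
          gcongr
          linarith
      _ = r := by field_simp; ring

end Motion

/-! ### The momentum carried by precolliding particles -/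

section Majorant

variable {d : ℕ} {r : ℝ} {W : ℝ → ℝ} {a₀ : ℝ → ℝ} {b : Transverse d → ℝ} {k : ℝ → ℝ → ℝ}
  {Vinf p γs θ w c C : ℝ} {B : Set (Transverse d)}

/-- The weight `ℓ(u_x - w) b(u_⊥)`, restricted to `V_∞ ≤ u_x ≤ V_∞ + θ` and `u_⊥ ∈ B`. -/
noncomputable def slabWeight (b : Transverse d → ℝ) (k : ℝ → ℝ → ℝ) (Vinf θ w : ℝ)
    (B : Set (Transverse d)) (u : Velocity d) : ℝ :=
  (Icc Vinf (Vinf + θ)).indicator (fun z => ell k (z - w)) u.1 * B.indicator b u.2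

theorem slabWeight_nonneg (hS : StructureAssumption a₀ b k) (u : Velocity d) :
    0 ≤ slabWeight b k Vinf θ w B u :=
  mul_nonneg (indicator_nonneg (fun _ _ => ell_nonneg hS.k_nonneg _) _)
    (indicator_nonneg (fun _ _ => hS.b_nonneg _) _)

theorem integrable_slabWeight (hS : StructureAssumption a₀ b k) (hell : Continuous (ell k))
    (hB : MeasurableSet B) : Integrable (slabWeight b k Vinf θ w B) := by
  refine Integrable.mul_prod (f := (Icc Vinf (Vinf + θ)).indicator (fun z => ell k (z - w)))
    (g := B.indicator b) ?_ ((integrable_b hS).indicator hB)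
  rw [integrable_indicator_iff measurableSet_Icc]
  exact (by fun_prop : Continuous fun z => ell k (z - w)).continuousOn.integrableOn_Icc

theorem integral_slabWeight_le (hS : StructureAssumption a₀ b k) (hell : Continuous (ell k))
    (hp : 0 < p) (hC : 0 < C) (hup : ∀ w, |w| ≤ γs → ell k w ≤ C * |w| ^ p)
    (hB : MeasurableSet B) (hθ : 0 ≤ θ) (hθs : θ ≤ γs) (hw : w ∈ Icc Vinf (Vinf + θ)) :
    ∫ u, slabWeight b k Vinf θ w B u ≤ C * θ ^ (p + 1) * ∫ y in B, b y := by
  have h1 : ∫ u, slabWeight b k Vinf θ w B u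
      = (∫ z in Icc Vinf (Vinf + θ), ell k (z - w)) * ∫ y in B, b y := by
    rw [← integral_indicator measurableSet_Icc, ← integral_indicator hB, ← integral_prod_mul]
    rfl
  rw [h1]
  refine mul_le_mul_of_nonneg_right ?_ (integral_nonneg fun _ => hS.b_nonneg _)
  calc ∫ z in Icc Vinf (Vinf + θ), ell k (z - w)
      ≤ ∫ _ in Icc Vinf (Vinf + θ), C * θ ^ p := by
        refine setIntegral_mono_on
          (by fun_prop : Continuous fun z => ell k (z - w)).continuousOn.integrableOn_Icc
          (integrableOn_const (by simp)) measurableSet_Icc fun z hz => ?_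
        have h2 : |z - w| ≤ θ := by
          rw [abs_le]; constructor <;> linarith [hz.1, hz.2, hw.1, hw.2]
        refine (hup _ (h2.trans hθs)).trans ?_
        gcongr
    _ = C * θ ^ (p + 1) := by
        rw [setIntegral_const, Real.volume_real_Icc_of_le (by linarith), smul_eq_mul,
          add_sub_cancel_left]
        rcases hθ.eq_or_lt with rfl | h
        · rw [Real.zero_rpow (by linarith : p + 1 ≠ 0)]; ring
        · rw [Real.rpow_add h, Real.rpow_one]; ring

theorem slabWeight_of_mem {u : Velocity d} (h1 : u.1 ∈ Icc Vinf (Vinf + θ)) (h2 : u.2 ∈ B) :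
    slabWeight b k Vinf θ w B u = ell k (u.1 - w) * b u.2 := by
  rw [slabWeight, indicator_of_mem h1, indicator_of_mem h2]

theorem exists_b_le (hS : StructureAssumption a₀ b k) (hIrr : IrreversalCriterion a₀ k Vinf) :
    ∃ A, 0 < A ∧ ∀ y, b y ≤ A := by
  obtain ⟨D, hD⟩ := hS.f₀_bounded
  have hz : ∃ z, 0 < a₀ z := by
    by_contra! hcon
    have h0 : ∀ z, a₀ z = 0 := fun z => le_antisymm (hcon z) (hS.a₀_nonneg z)
    simp [IrreversalCriterion, h0] at hIrr
  obtain ⟨z, hz⟩ := hz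
  refine ⟨|D| / a₀ z + 1, by positivity, fun y => ?_⟩
  have h := hD (z, y)
  rw [initialDensity, mul_comm, ← le_div_iff₀ hz] at h
  have : D / a₀ z ≤ |D| / a₀ z := by
    gcongr
    exact le_abs_self D
  simp only at h
  linarith

theorem volume_real_closedBall {ρ : ℝ} (hρ : 0 ≤ ρ) :
    volume.real (Metric.closedBall (0 : Transverse d) ρ)
      = ρ ^ (d - 1) * volume.real (Metric.ball (0 : Transverse d) 1) := by
  rw [Measure.real, Measure.addHaar_closedBall _ _ hρ, ENNReal.toReal_mul,
    ENNReal.toReal_ofReal (by positivity), finrank_euclideanSpace_fin]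
  rfl

theorem volume_real_ball_pos : 0 < volume.real (Metric.ball (0 : Transverse d) 1) :=
  ENNReal.toReal_pos (Metric.measure_ball_pos volume _ one_pos).ne' measure_ball_lt_top.ne

/-- Powers of `t` from the horizontal velocities, of order `t^{-(p+1)}`, and from the transverse
velocities, of order `t^{-(d-1)}`, combine to `t^{-(p+d)}`. -/
theorem rpow_mul_pow_eq (hd : 1 ≤ d) {t : ℝ} (ht : 0 < t) (a q : ℝ) :
    (1 / t) ^ (p + 1) * (1 / t) ^ (d - 1) * (a * q) = a * q / t ^ (p + d) := by
  have h1 : ((1 : ℝ) / t) ^ (d - 1) = (1 / t) ^ ((d : ℝ) - 1) := by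
    rw [← Real.rpow_natCast, Nat.cast_sub hd, Nat.cast_one]
  rw [h1, ← Real.rpow_add (by positivity), one_div, Real.inv_rpow ht.le,
    show p + 1 + ((d : ℝ) - 1) = p + d by ring]
  field_simp

/-- A precollision either lies in the first half of `[0, t]`, and then the transverse velocity is
`O(1/t)` and the horizontal one deviates from `V_∞` by `O((γ + α)/t)`, or it lies in the second
half, and then the horizontal velocity deviates by `O((γ + α) t^{-(p+d)})`. -/
theorem exists_precollision_majorant (hd : 1 ≤ d) (hr : 0 < r) (hS : StructureAssumption a₀ b k)
    (hIrr : IrreversalCriterion a₀ k Vinf) (hp : 0 < p) (hp2 : p ≤ 2) (hγs : 0 < γs)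
    (hPow : PowerLawAssumption k p γs) {β : ℝ} (hβ : 0 < β) :
    ∃ C η₁ : ℝ, 0 < C ∧ 0 < η₁ ∧ ∀ {γ α K : ℝ} {W : ℝ → ℝ},
      DecayingMotion Vinf γ α β K (p + d) W → 0 < γ → 0 < α → γ + α ≤ η₁ → ∀ t, 0 ≤ t →
        ∀ x ∈ crossSection d r, ∃ g : Velocity d → ℝ, Integrable g ∧
          (∫ u, g u ≤ C * (γ + α) ^ (p + 1) / (1 + t) ^ (p + d)) ∧ (∀ u, 0 ≤ g u) ∧
          ∀ u, (precollisionTimes r W t x u).Nonempty → ell k (u.1 - W t) * b u.2 ≤ g u := by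
  obtain ⟨c, C, hc, hC, hell⟩ := exists_ell_two_sided hp hp2 hγs hPow
  have hcont := continuous_ell hS.k_nonneg hp hγs hPow
  have hup : ∀ w, |w| ≤ γs → ell k w ≤ C * |w| ^ p := fun w hw => (hell w hw).2
  obtain ⟨A, hA, hbA⟩ := exists_b_le hS hIrr
  have hd1 : (1 : ℝ) ≤ d := by exact_mod_cast hd
  have hN : 1 < p + (d : ℝ) := by linarith
  obtain ⟨C₂, hC₂, htail⟩ := exists_sub_le_of_half_le hβ hN
  set N := p + (d : ℝ) with hNdef
  have hN1 : 0 < N - 1 := by linarith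
  set C₁ := 2 * (1 / β + 1 / (N - 1)) + 1 with hC₁
  have hC₁0 : 0 < C₁ := by positivity
  have hC₁' : 1 / β + 1 ≤ C₁ := by
    have h1 : 0 < 1 / β := by positivity
    have h2 : 0 < 1 / (N - 1) := by positivity
    linarith
  set κ := volume.real (Metric.ball (0 : Transverse d) 1)
  have hκ : 0 < κ := volume_real_ball_pos
  have hbint : ∫ y in univ, b y = 1 := by rw [setIntegral_univ, hS.b_integral]
  set D₁ := C * C₁ ^ (p + 1) * (A * ((4 * r) ^ (d - 1) * κ)) with hD₁
  set D₂ := C * C₂ ^ (p + 1) with hD₂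
  have hD₁0 : 0 < D₁ := by positivity
  have hD₂0 : 0 < D₂ := by positivity
  refine ⟨2 ^ N * C + (2 ^ N * D₁ + D₂), min γs (min (γs / C₁) (γs / C₂)), by positivity,
    by positivity, ?_⟩
  intro γ α K W hM hγ hα hη t ht x hx
  have hη0 : 0 < γ + α := by linarith
  have hη1 : γ + α ≤ γs := hη.trans (min_le_left _ _)
  have hη2 : C₁ * (γ + α) ≤ γs := by
    have := hη.trans ((min_le_right _ _).trans (min_le_left _ _))
    rw [le_div_iff₀ hC₁0] at this
    linarith
  have hη3 : C₂ * (γ + α) ≤ γs := by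
    have := hη.trans ((min_le_right _ _).trans (min_le_right _ _))
    rw [le_div_iff₀ hC₂] at this
    linarith
  have hηp : 0 < (γ + α) ^ (p + 1) := by positivity
  rcases le_or_gt t 1 with ht1 | ht1
  · refine ⟨slabWeight b k Vinf (γ + α) (W t) univ, integrable_slabWeight hS hcont
      MeasurableSet.univ, ?_, slabWeight_nonneg hS, fun u hu => ?_⟩
    · have h1 := integral_slabWeight_le hS hcont hp hC hup MeasurableSet.univ hη0.le hη1
        (hM.range t)
      rw [hbint, mul_one] at h1
      refine h1.trans ?_
      rw [le_div_iff₀ (by positivity)]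
      have h2 : (1 + t) ^ N ≤ 2 ^ N := by gcongr; linarith
      calc C * (γ + α) ^ (p + 1) * (1 + t) ^ N ≤ C * (γ + α) ^ (p + 1) * 2 ^ N := by gcongr
        _ = (2 ^ N * C) * (γ + α) ^ (p + 1) := by ring
        _ ≤ _ := by
          gcongr
          have : 0 < 2 ^ N * D₁ + D₂ := by positivity
          linarith
    · rw [slabWeight_of_mem (fst_mem_of_precollision hM.continuous hM.range hu) (mem_univ _)]
  · have ht0 : 0 < t := by linarith
    set θ₁ := C₁ * (γ + α) / t with hθ₁
    set θ₂ := C₂ * (γ + α) / (1 + t) ^ N with hθ₂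
    have hpow1 : 1 ≤ (1 + t) ^ N := Real.one_le_rpow (by linarith) (by linarith)
    have hθ₁s : θ₁ ≤ γs := (div_le_self (by positivity) ht1.le).trans hη2
    have hθ₂s : θ₂ ≤ γs := (div_le_self (by positivity) hpow1).trans hη3
    have hW1 : W t ∈ Icc Vinf (Vinf + θ₁) := by
      refine ⟨(hM.range t).1, ?_⟩
      have h1 := hM.sub_le_div hγ hα hβ hN ht0
      have h2 : (1 / β + 1) * (γ + α) / t ≤ θ₁ := by
        rw [hθ₁]; gcongr
      linarith
    have hW2 : W t ∈ Icc Vinf (Vinf + θ₂) := by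
      refine ⟨(hM.range t).1, ?_⟩
      have := htail hM hγ hα t t ht (by linarith)
      linarith
    have hball : MeasurableSet (Metric.closedBall (0 : Transverse d) (4 * r / t)) :=
      measurableSet_closedBall
    refine ⟨fun u => slabWeight b k Vinf θ₁ (W t) (Metric.closedBall 0 (4 * r / t)) u +
      slabWeight b k Vinf θ₂ (W t) univ u, (integrable_slabWeight hS hcont hball).add
        (integrable_slabWeight hS hcont MeasurableSet.univ), ?_,
      fun u => add_nonneg (slabWeight_nonneg hS u) (slabWeight_nonneg hS u), fun u hu => ?_⟩
    · rw [integral_add (integrable_slabWeight hS hcont hball)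
        (integrable_slabWeight hS hcont MeasurableSet.univ)]
      have h1 := integral_slabWeight_le hS hcont hp hC hup hball
        (by positivity : 0 ≤ θ₁) hθ₁s hW1
      have h2 := integral_slabWeight_le hS hcont hp hC hup MeasurableSet.univ
        (by positivity : 0 ≤ θ₂) hθ₂s hW2
      rw [hbint, mul_one] at h2
      have h3 : ∫ y in Metric.closedBall (0 : Transverse d) (4 * r / t), b y
          ≤ A * ((4 * r / t) ^ (d - 1) * κ) := by
        rw [← volume_real_closedBall (by positivity)]
        refine (Real.le_norm_self _).trans ?_
        refine norm_setIntegral_le_of_norm_le_const measure_closedBall_lt_top fun y _ => ?_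
        rw [Real.norm_of_nonneg (hS.b_nonneg y)]
        exact hbA y
      have h4 : C * θ₁ ^ (p + 1) * (A * ((4 * r / t) ^ (d - 1) * κ))
          = D₁ * (γ + α) ^ (p + 1) / t ^ N := by
        rw [hNdef, ← rpow_mul_pow_eq hd ht0, hθ₁, hD₁,
          show C₁ * (γ + α) / t = C₁ * (γ + α) * (1 / t) by ring,
          show 4 * r / t = (4 * r) * (1 / t) by ring,
          Real.mul_rpow (by positivity) (by positivity),
          Real.mul_rpow (by positivity) (by positivity), mul_pow]
        ring
      have h5 : D₁ * (γ + α) ^ (p + 1) / t ^ N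
          ≤ 2 ^ N * D₁ * (γ + α) ^ (p + 1) / (1 + t) ^ N := by
        rw [div_le_div_iff₀ (by positivity) (by positivity)]
        have h6 : (1 + t) ^ N ≤ 2 ^ N * t ^ N := by
          rw [← Real.mul_rpow (by norm_num) ht0.le]
          gcongr
          linarith
        calc D₁ * (γ + α) ^ (p + 1) * (1 + t) ^ N
            ≤ D₁ * (γ + α) ^ (p + 1) * (2 ^ N * t ^ N) := by gcongr
          _ = _ := by ring
      have h7 : C * θ₂ ^ (p + 1) ≤ D₂ * (γ + α) ^ (p + 1) / (1 + t) ^ N := by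
        rw [hθ₂, hD₂, Real.div_rpow (by positivity) (by positivity),
          Real.mul_rpow (by positivity) (by positivity), ← mul_div_assoc, ← mul_assoc]
        gcongr
        exact Real.self_le_rpow_of_one_le hpow1 (by linarith)
      calc _ ≤ C * θ₁ ^ (p + 1) * (A * ((4 * r / t) ^ (d - 1) * κ)) + C * θ₂ ^ (p + 1) := by
            refine add_le_add (h1.trans ?_) h2
            gcongr
        _ ≤ 2 ^ N * D₁ * (γ + α) ^ (p + 1) / (1 + t) ^ N
            + D₂ * (γ + α) ^ (p + 1) / (1 + t) ^ N := add_le_add (h4.le.trans h5) h7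
        _ = (2 ^ N * D₁ + D₂) * (γ + α) ^ (p + 1) / (1 + t) ^ N := by ring
        _ ≤ _ := by
            refine div_le_div_of_nonneg_right (mul_le_mul_of_nonneg_right ?_ hηp.le)
              (by positivity)
            have : 0 < 2 ^ N * C := by positivity
            linarith
    · obtain ⟨s, hs0, hst, hu1, hu2⟩ := hu
      have hlow : Vinf ≤ u.1 := by
        rw [hu1]
        exact le_timeAverage hst hM.continuous fun σ _ => (hM.range σ).1
      rcases le_or_gt s (t / 2) with hs | hs
      · have h1 := hM.timeAverage_le_of_le_half hγ hα hβ hN hs0 hst hs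
        rw [← hu1] at h1
        have h2 : 2 * (1 / β + 1 / (N - 1)) * (γ + α) / t ≤ θ₁ := by
          rw [hθ₁]
          gcongr
          linarith
        have h3 : u.2 ∈ Metric.closedBall (0 : Transverse d) (4 * r / t) := by
          rw [mem_closedBall_zero_iff, le_div_iff₀ ht0]
          rw [crossSection, mem_closedBall_zero_iff] at hu2 hx
          have h4 : ‖(t - s) • u.2‖ ≤ 2 * r := by
            calc ‖(t - s) • u.2‖ = ‖x - (x - (t - s) • u.2)‖ := by rw [sub_sub_cancel]
              _ ≤ ‖x‖ + ‖x - (t - s) • u.2‖ := norm_sub_le _ _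
              _ ≤ 2 * r := by linarith
          rw [norm_smul, Real.norm_of_nonneg (by linarith)] at h4
          nlinarith [norm_nonneg u.2]
        have hmem : u.1 ∈ Icc Vinf (Vinf + θ₁) := ⟨hlow, by linarith⟩
        simp only
        rw [slabWeight_of_mem hmem h3]
        linarith [slabWeight_nonneg (Vinf := Vinf) (θ := θ₂) (w := W t) (B := univ) hS u]
      · have h1 : u.1 ≤ Vinf + θ₂ := by
          rw [hu1]
          refine timeAverage_le hst hM.continuous fun σ hσ => ?_
          have := htail hM hγ hα σ t ht (by linarith [hσ.1])
          linarith
        have hmem : u.1 ∈ Icc Vinf (Vinf + θ₂) := ⟨hlow, h1⟩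
        simp only
        rw [slabWeight_of_mem hmem (mem_univ _)]
        linarith [slabWeight_nonneg (Vinf := Vinf) (θ := θ₁) (w := W t)
          (B := Metric.closedBall 0 (4 * r / t)) hS u]

end Majorant

/-! ### The two parts of the precollision force -/

section Force

variable {d : ℕ} {r : ℝ} {W W' : ℝ → ℝ} {a₀ : ℝ → ℝ} {b : Transverse d → ℝ} {k : ℝ → ℝ → ℝ}
  {e : BodyEnd} {Vinf p γs η G : ℝ} {t : ℝ}

/-- The momentum `∫_D ∫ ℓ(u_x - W(t)) (f_- - f₀) d𝐮 dx_⊥` that precollisions add at one end. -/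
noncomputable def endMomentum {d : ℕ} (r : ℝ) (a₀ : ℝ → ℝ) (b : Transverse d → ℝ) (k : ℝ → ℝ → ℝ)
    (W : ℝ → ℝ) (e : BodyEnd) (t : ℝ) : ℝ :=
  ∫ x in crossSection d r, ∫ u in {u : Velocity d | u.1 ∈ incomingVelocities (W t) e},
    ell k (u.1 - W t) * densityChange r a₀ b k W e t x u

theorem precollisionForce_eq : precollisionForce r a₀ b k W t
    = -endMomentum r a₀ b k W BodyEnd.left t + endMomentum r a₀ b k W BodyEnd.right t := by
  rw [precollisionForce, endMomentum, endMomentum, ← integral_neg]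
  congr 1
  refine integral_congr_ae (Eventually.of_forall fun x => ?_)
  simp only
  rw [← integral_neg]
  refine integral_congr_ae (Eventually.of_forall fun u => ?_)
  simp only [densityChange]
  ring

theorem precollisionForce_congr (h : EqOn W W' (Ici 0)) (ht : 0 ≤ t) :
    precollisionForce r a₀ b k W t = precollisionForce r a₀ b k W' t := by
  simp only [precollisionForce, densityBefore_congr h, h (mem_Ici.2 ht)]

theorem precollisionForceConverges_congr (h : EqOn W W' (Ici 0)) (ht : 0 ≤ t) :
    PrecollisionForceConverges r a₀ b k W t ↔ PrecollisionForceConverges r a₀ b k W' t := by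
  simp only [PrecollisionForceConverges, densityBefore_congr h, h (mem_Ici.2 ht)]

theorem measurable_momentum_integrand (hS : StructureAssumption a₀ b k)
    (hell : Continuous (ell k)) (hW : Continuous W) :
    Measurable fun q : Transverse d × Velocity d =>
      ell k (q.2.1 - W t) * densityChange r a₀ b k W e t q.1 q.2 := by
  have h1 := (measurable_densityBefore (r := r) (e := e) hS hW).comp
    (measurable_const (a := t) |>.prodMk (measurable_id (α := Transverse d × Velocity d)))
  have h2 : Measurable fun q : Transverse d × Velocity d => ell k (q.2.1 - W t) :=
    hell.measurable.comp (by fun_prop)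
  exact h2.mul (h1.ennreal_toReal.sub ((measurable_initialDensity hS).comp measurable_snd))

theorem abs_momentum_integrand_le (hS : StructureAssumption a₀ b k) (hG : 0 ≤ G)
    (hδ : ∀ e t x u, |densityChange r a₀ b k W e t x u| ≤ G * b u.2) {g : ℝ} (hg : 0 ≤ g)
    {x : Transverse d} {u : Velocity d}
    (h : (precollisionTimes r W t x u).Nonempty → ell k (u.1 - W t) * b u.2 ≤ g) :
    |ell k (u.1 - W t) * densityChange r a₀ b k W e t x u| ≤ G * g := by
  by_cases hne : (precollisionTimes r W t x u).Nonempty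
  · have h1 := ell_nonneg hS.k_nonneg (u.1 - W t)
    rw [abs_mul, abs_of_nonneg h1]
    calc ell k (u.1 - W t) * |densityChange r a₀ b k W e t x u|
        ≤ ell k (u.1 - W t) * (G * b u.2) := by gcongr; exact hδ _ _ _ _
      _ = G * (ell k (u.1 - W t) * b u.2) := by ring
      _ ≤ G * g := by gcongr; exact h hne
  · rw [densityChange_eq_zero hS hne, mul_zero, abs_zero]
    positivity

theorem norm_momentum_integrand_le (hS : StructureAssumption a₀ b k) (hW : Continuous W)
    (hI : ∀ t, W t ∈ Icc Vinf (Vinf + η)) (hG : 0 ≤ G)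
    (hδ : ∀ e t x u, |densityChange r a₀ b k W e t x u| ≤ G * b u.2)
    (x : Transverse d) (u : Velocity d) :
    ‖ell k (u.1 - W t) * densityChange r a₀ b k W e t x u‖
      ≤ G * slabWeight b k Vinf η (W t) univ u :=
  abs_momentum_integrand_le hS hG hδ (slabWeight_nonneg hS u) fun h => by
    rw [slabWeight_of_mem (fst_mem_of_precollision hW hI h) (mem_univ _)]

theorem integrable_momentum_slice (hS : StructureAssumption a₀ b k)
    (hell : Continuous (ell k)) (hW : Continuous W)
    (hI : ∀ t, W t ∈ Icc Vinf (Vinf + η)) (hG : 0 ≤ G)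
    (hδ : ∀ e t x u, |densityChange r a₀ b k W e t x u| ≤ G * b u.2) (x : Transverse d) :
    Integrable fun u : Velocity d =>
      ell k (u.1 - W t) * densityChange r a₀ b k W e t x u := by
  refine Integrable.mono' ((integrable_slabWeight hS hell MeasurableSet.univ).const_mul G)
    ?_ (Eventually.of_forall (norm_momentum_integrand_le hS hW hI hG hδ x))
  exact ((measurable_momentum_integrand hS hell hW).comp
    (measurable_const (a := x) |>.prodMk measurable_id)).aestronglyMeasurable

theorem integrableOn_momentum (hS : StructureAssumption a₀ b k)
    (hell : Continuous (ell k)) (hW : Continuous W)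
    (hI : ∀ t, W t ∈ Icc Vinf (Vinf + η)) (hG : 0 ≤ G)
    (hδ : ∀ e t x u, |densityChange r a₀ b k W e t x u| ≤ G * b u.2) (S : Set (Velocity d)) :
    IntegrableOn (fun q : Transverse d × Velocity d =>
      ell k (q.2.1 - W t) * densityChange r a₀ b k W e t q.1 q.2) (crossSection d r ×ˢ S) := by
  have hfin : IsFiniteMeasure ((volume : Measure (Transverse d)).restrict (crossSection d r)) :=
    isFiniteMeasure_restrict.2 measure_closedBall_lt_top.ne
  rw [IntegrableOn, Measure.volume_eq_prod, ← Measure.prod_restrict]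
  refine Integrable.mono' ((((integrable_slabWeight (Vinf := Vinf) (θ := η) (w := W t) hS hell
    MeasurableSet.univ).const_mul G).restrict (s := S)).comp_snd
      ((volume : Measure (Transverse d)).restrict (crossSection d r))) ?_
    (Eventually.of_forall fun q => norm_momentum_integrand_le hS hW hI hG hδ q.1 q.2)
  exact (measurable_momentum_integrand hS hell hW).aestronglyMeasurable

theorem precollisionForceConverges (hS : StructureAssumption a₀ b k)
    (hell : Continuous (ell k)) (hW : Continuous W)
    (hI : ∀ t, W t ∈ Icc Vinf (Vinf + η)) (hG : 0 ≤ G)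
    (hfin : ∀ e t x u, densityBefore r a₀ b k W e t x u < ∞)
    (hδ : ∀ e t x u, |densityChange r a₀ b k W e t x u| ≤ G * b u.2) :
    PrecollisionForceConverges r a₀ b k W t := by
  intro e
  refine ⟨Eventually.of_forall fun q => hfin e t q.1 q.2, ?_⟩
  refine (integrableOn_momentum (t := t) (e := e) hS hell hW hI hG hδ _).neg.congr
    (Eventually.of_forall fun q => ?_)
  simp only [Pi.neg_apply, densityChange]
  ring

theorem abs_endMomentum_le (hS : StructureAssumption a₀ b k) (hG : 0 ≤ G)
    (hδ : ∀ e t x u, |densityChange r a₀ b k W e t x u| ≤ G * b u.2) {Q : ℝ}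
    (h : ∀ x ∈ crossSection d r, ∃ g : Velocity d → ℝ, Integrable g ∧ (∫ u, g u ≤ Q) ∧
      (∀ u, 0 ≤ g u) ∧ ∀ u : Velocity d, u.1 ∈ incomingVelocities (W t) e →
        (precollisionTimes r W t x u).Nonempty → ell k (u.1 - W t) * b u.2 ≤ g u) :
    |endMomentum r a₀ b k W e t| ≤ G * Q * volume.real (crossSection d r) := by
  rw [← Real.norm_eq_abs, endMomentum]
  refine norm_setIntegral_le_of_norm_le_const measure_closedBall_lt_top fun x hx => ?_
  obtain ⟨g, hgi, hgQ, hg0, hg⟩ := h x hx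
  calc ‖∫ u in {u : Velocity d | u.1 ∈ incomingVelocities (W t) e},
        ell k (u.1 - W t) * densityChange r a₀ b k W e t x u‖
      ≤ ∫ u in {u : Velocity d | u.1 ∈ incomingVelocities (W t) e}, G * g u :=
        norm_integral_le_of_norm_le (hgi.const_mul G).restrict
          (ae_restrict_of_forall_mem (measurableSet_incoming_slice _) fun u hu =>
            abs_momentum_integrand_le hS hG hδ (hg0 u) (hg u hu))
    _ ≤ ∫ u, G * g u := setIntegral_le_integral (hgi.const_mul G)
        (Eventually.of_forall fun u => mul_nonneg hG (hg0 u))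
    _ = G * ∫ u, g u := integral_const_mul _ _
    _ ≤ G * Q := by gcongr

theorem momentum_integrand_left_nonneg (hS : StructureAssumption a₀ b k) {ε : ℝ} (hε : 0 ≤ ε)
    (hleft : ∀ t x (u : Velocity d), (precollisionTimes r W t x u).Nonempty →
      ε * b u.2 ≤ densityChange r a₀ b k W BodyEnd.left t x u) (x : Transverse d)
    (u : Velocity d) :
    0 ≤ ell k (u.1 - W t) * densityChange r a₀ b k W BodyEnd.left t x u := by
  refine mul_nonneg (ell_nonneg hS.k_nonneg _) ?_
  by_cases hne : (precollisionTimes r W t x u).Nonempty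
  · exact (mul_nonneg hε (hS.b_nonneg _)).trans (hleft t x u hne)
  · rw [densityChange_eq_zero hS hne]

theorem endMomentum_left_nonneg (hS : StructureAssumption a₀ b k) {ε : ℝ} (hε : 0 ≤ ε)
    (hleft : ∀ t x (u : Velocity d), (precollisionTimes r W t x u).Nonempty →
      ε * b u.2 ≤ densityChange r a₀ b k W BodyEnd.left t x u) :
    0 ≤ endMomentum r a₀ b k W BodyEnd.left t :=
  integral_nonneg fun x => integral_nonneg fun u => momentum_integrand_left_nonneg hS hε hleft x u

/-- As long as the body decelerates it is never overtaken by particles reflected at its right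
end. -/
theorem endMomentum_right_eq_zero (hS : StructureAssumption a₀ b k) (hell0 : ell k 0 = 0)
    (hW : Continuous W) (hanti : AntitoneOn W (Icc 0 t)) :
    endMomentum r a₀ b k W BodyEnd.right t = 0 := by
  rw [endMomentum]
  refine integral_eq_zero_of_ae (Eventually.of_forall fun x => ?_)
  refine setIntegral_eq_zero_of_forall_eq_zero fun u hu => ?_
  by_cases hne : (precollisionTimes r W t x u).Nonempty
  · obtain ⟨s, hs0, hst, hu1, -⟩ := hne
    have h1 : W t ≤ u.1 := by
      rw [hu1]
      exact le_timeAverage hst hW fun σ hσ =>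
        hanti ⟨hs0.le.trans hσ.1, hσ.2⟩ ⟨(hs0.trans hst).le, le_rfl⟩ hσ.2
    have h2 : u.1 = W t := le_antisymm hu h1
    rw [h2, sub_self, hell0, zero_mul]
  · rw [densityChange_eq_zero hS hne, mul_zero]

/-- Particles that precollide at the right end have velocities between `V_∞` and `W(t)`. -/
theorem abs_endMomentum_right_le (hS : StructureAssumption a₀ b k) (hell : Continuous (ell k))
    (hp : 0 < p) {C : ℝ} (hC : 0 < C) (hup : ∀ w, |w| ≤ γs → ell k w ≤ C * |w| ^ p)
    (hW : Continuous W) (hI : ∀ t, W t ∈ Icc Vinf (Vinf + η)) (hη : η ≤ γs) (hG : 0 ≤ G)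
    (hδ : ∀ e t x u, |densityChange r a₀ b k W e t x u| ≤ G * b u.2) :
    |endMomentum r a₀ b k W BodyEnd.right t|
      ≤ G * (C * (W t - Vinf) ^ (p + 1)) * volume.real (crossSection d r) := by
  refine abs_endMomentum_le hS hG hδ fun x _ =>
    ⟨slabWeight b k Vinf (W t - Vinf) (W t) univ, integrable_slabWeight hS hell
      MeasurableSet.univ, ?_, slabWeight_nonneg hS, fun u hu hne => ?_⟩
  · have h := integral_slabWeight_le (Vinf := Vinf) (θ := W t - Vinf) (w := W t) hS hell hp hC hup
      MeasurableSet.univ (sub_nonneg.2 (hI t).1) (by linarith [(hI t).2])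
      ⟨(hI t).1, by linarith⟩
    rwa [setIntegral_univ, hS.b_integral, mul_one] at h
  · have h1 := fst_mem_of_precollision hW hI hne
    have h2 : u.1 ≤ W t := hu
    rw [slabWeight_of_mem ⟨h1.1, by linarith⟩ (mem_univ _)]

/-- For large times a set of velocities of size comparable with `γ/t` in the horizontal and `1/t`
in the transverse directions precollides at the left end. -/
theorem exists_le_endMomentum_left (hd : 1 ≤ d) (hr : 0 < r) (hS : StructureAssumption a₀ b k)
    (hp : 0 < p) (hp2 : p ≤ 2) (hγs : 0 < γs) (hPow : PowerLawAssumption k p γs)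
    {β K ε : ℝ} (hβ : 0 < β) (hK : 0 < K) (hε : 0 < ε) :
    ∃ c₁ T a : ℝ, 0 < c₁ ∧ 0 < a ∧ ∀ {Vinf γ α G : ℝ} {W : ℝ → ℝ},
      DecayingMotion Vinf γ α β K (p + d) W → 0 < γ → 0 < α → γ ≤ γs → α ≤ a * γ → 0 ≤ G →
      (∀ e t x (u : Velocity d), |densityChange r a₀ b k W e t x u| ≤ G * b u.2) →
      (∀ t x (u : Velocity d), (precollisionTimes r W t x u).Nonempty →
        ε * b u.2 ≤ densityChange r a₀ b k W BodyEnd.left t x u) →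
      ∀ t, T ≤ t → c₁ * γ ^ (p + 1) / t ^ (p + d) ≤ endMomentum r a₀ b k W BodyEnd.left t := by
  obtain ⟨c, _, hc, -, hell2⟩ := exists_ell_two_sided hp hp2 hγs hPow
  have hell := continuous_ell hS.k_nonneg hp hγs hPow
  obtain ⟨ρ, hρ, hρb⟩ := Metric.continuous_iff.1 hS.b_continuous 0 (b 0 / 2)
    (by have := hS.b_zero_pos; positivity)
  obtain ⟨C, hC, hexp⟩ := exists_exp_le_rpow (q := 2) hβ two_pos
  have hd1 : (1 : ℝ) ≤ d := by exact_mod_cast hd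
  set E := Real.exp (-K) with hE
  have hE0 : 0 < E := Real.exp_pos _
  have hE1 : E ≤ 1 := Real.exp_le_one_iff.2 (by linarith)
  set κ := volume.real (Metric.ball (0 : Transverse d) 1)
  have hκ : 0 < κ := volume_real_ball_pos
  have hb0 := hS.b_zero_pos
  set v := volume.real (Metric.closedBall (0 : Transverse d) (r / 2)) with hv
  have hv0 : 0 < v := ENNReal.toReal_pos
    (Metric.measure_closedBall_pos volume _ (by positivity)).ne' measure_closedBall_lt_top.ne
  set c₁ := (E / 4) ^ (p + 1) * (c * (ε * (b 0 / 2)) * ((r / 2) ^ (d - 1) * κ) * v) with hc₁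
  refine ⟨c₁, max 1 (max (r / ρ) (8 * C / E)), E / 8, by positivity, by positivity, ?_⟩
  intro Vinf γ α G W hM hγ hα hγγ hαγ hG hδ hleft t ht
  have ht1 : 1 ≤ t := (le_max_left _ _).trans ht
  have ht0 : 0 < t := by linarith
  have ht2 : r / ρ ≤ t := ((le_max_left _ _).trans (le_max_right _ _)).trans ht
  have ht3 : 8 * C / E ≤ t := ((le_max_right _ _).trans (le_max_right _ _)).trans ht
  have hW := hM.continuous
  -- the horizontal velocities will range over a part of the interval `(W t, V_∞ + 4 h)`
  set h := γ * E / (4 * t) with hh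
  have hh0 : 0 < h := by positivity
  have hWt : W t - Vinf ≤ h := by
    have h1 : Real.exp (-β * t) ≤ E / (8 * t) := by
      refine (hexp t ht0.le).trans ?_
      rw [div_le_iff₀ hE0] at ht3
      rw [div_le_div_iff₀ (by positivity) (by positivity), Real.rpow_two]
      nlinarith
    have h2 : α / (1 + t) ^ (p + (d : ℝ)) ≤ E / 8 * γ / t := by
      gcongr
      calc t ≤ 1 + t := by linarith
        _ ≤ (1 + t) ^ (p + (d : ℝ)) := Real.self_le_rpow_of_one_le (by linarith) (by linarith)
    calc W t - Vinf ≤ γ * Real.exp (-β * t) + α / (1 + t) ^ (p + (d : ℝ)) := hM.upper t ht0.le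
      _ ≤ γ * (E / (8 * t)) + E / 8 * γ / t := by gcongr
      _ = h := by rw [hh]; field_simp; norm_num
  have hhγ : 4 * h ≤ γ := by
    rw [hh]
    calc 4 * (γ * E / (4 * t)) = γ * E / t := by field_simp
      _ ≤ γ * E := div_le_self (by positivity) ht1
      _ ≤ γ := by nlinarith
  set P : Set (Velocity d) :=
    Icc (Vinf + 2 * h) (Vinf + 3 * h) ×ˢ Metric.closedBall (0 : Transverse d) (r / (2 * t)) with hP
  have hPm : MeasurableSet P := measurableSet_Icc.prod measurableSet_closedBall
  have hPsub : P ⊆ {u : Velocity d | u.1 ∈ incomingVelocities (W t) BodyEnd.left} := by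
    intro u hu
    have h1 : W t ≤ u.1 := by linarith [hu.1.1]
    exact h1
  have hPvol : (volume : Measure (Velocity d)).real P = h * ((r / (2 * t)) ^ (d - 1) * κ) := by
    rw [hP, Measure.volume_eq_prod, measureReal_prod_prod,
      Real.volume_real_Icc_of_le (by linarith), volume_real_closedBall (by positivity)]
    ring
  have hPfin : (volume : Measure (Velocity d)) P ≠ ∞ :=
    (isCompact_Icc.prod (isCompact_closedBall _ _)).measure_lt_top.ne
  set m := c * h ^ p * (ε * (b 0 / 2)) with hm
  have hm0 : 0 < m := by positivity
  have hslice : ∀ x ∈ Metric.closedBall (0 : Transverse d) (r / 2),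
      m * (h * ((r / (2 * t)) ^ (d - 1) * κ))
        ≤ ∫ u in {u : Velocity d | u.1 ∈ incomingVelocities (W t) BodyEnd.left},
          ell k (u.1 - W t) * densityChange r a₀ b k W BodyEnd.left t x u := by
    intro x hx
    rw [mem_closedBall_zero_iff] at hx
    have hi := integrable_momentum_slice (t := t) (e := BodyEnd.left) hS hell hW hM.range hG hδ x
    rw [← hPvol]
    refine le_trans ?_ (setIntegral_mono_set hi.integrableOn (Eventually.of_forall
      (momentum_integrand_left_nonneg hS hε.le hleft x)) hPsub.eventuallyLE)
    refine setIntegral_ge_of_const_le_real hPm hPfin (fun u hu => ?_) hi.integrableOn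
    obtain ⟨⟨hu1, hu1'⟩, hu2⟩ := hu
    rw [mem_closedBall_zero_iff] at hu2
    have hne : (precollisionTimes r W t x u).Nonempty := by
      refine hM.nonempty_precollisionTimes hγ hK.le ht1 hx hu2 (by linarith) ?_
      have : γ * Real.exp (-K) / t = 4 * h := by rw [← hE, hh]; field_simp
      rw [this]
      linarith
    have h1 : b 0 / 2 ≤ b u.2 := by
      have h2 : ‖u.2‖ < ρ := by
        refine hu2.trans_lt ?_
        rw [div_le_iff₀ hρ] at ht2
        rw [div_lt_iff₀ (by positivity)]
        nlinarith
      have h3 := hρb u.2 (by rwa [dist_zero_right])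
      rw [Real.dist_eq, abs_lt] at h3
      linarith [h3.1]
    have h4 : h ≤ u.1 - W t := by linarith
    have h5 : u.1 - W t ≤ 4 * h := by linarith [(hM.range t).1]
    have h6 : c * h ^ p ≤ ell k (u.1 - W t) := by
      refine le_trans ?_ (hell2 _ ?_).1
      · rw [abs_of_nonneg (by linarith)]
        gcongr
      · rw [abs_of_nonneg (by linarith)]
        linarith
    have h7 := hleft t x u hne
    have h8 : ε * (b 0 / 2) ≤ ε * b u.2 := by gcongr
    exact mul_le_mul h6 (h8.trans h7) (by positivity) (ell_nonneg hS.k_nonneg _)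
  have hint : IntegrableOn (fun x => ∫ u in
      {u : Velocity d | u.1 ∈ incomingVelocities (W t) BodyEnd.left},
        ell k (u.1 - W t) * densityChange r a₀ b k W BodyEnd.left t x u) (crossSection d r) := by
    have h1 := integrableOn_momentum (t := t) (e := BodyEnd.left) hS hell hW hM.range hG hδ
      {u : Velocity d | u.1 ∈ incomingVelocities (W t) BodyEnd.left}
    rw [IntegrableOn, Measure.volume_eq_prod, ← Measure.prod_restrict] at h1
    exact h1.integral_prod_left
  have hsub : Metric.closedBall (0 : Transverse d) (r / 2) ⊆ crossSection d r :=
    Metric.closedBall_subset_closedBall (by linarith)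
  calc c₁ * γ ^ (p + 1) / t ^ (p + (d : ℝ))
      = m * (h * ((r / (2 * t)) ^ (d - 1) * κ)) * v := by
        have h1 : h ^ p * h = (E / 4) ^ (p + 1) * γ ^ (p + 1) * (1 / t) ^ (p + 1) := by
          rw [← Real.rpow_add_one hh0.ne', ← Real.mul_rpow (by positivity) (by positivity),
            ← Real.mul_rpow (by positivity) (by positivity)]
          congr 1
          rw [hh]
          field_simp
        rw [← rpow_mul_pow_eq hd ht0, hm, hc₁,
          show r / (2 * t) = r / 2 * (1 / t) by field_simp, mul_pow]
        linear_combination (-(c * (ε * (b 0 / 2)) * ((r / 2) ^ (d - 1) * (1 / t) ^ (d - 1) * κ) *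
          v)) * h1
    _ ≤ ∫ x in Metric.closedBall (0 : Transverse d) (r / 2), ∫ u in
          {u : Velocity d | u.1 ∈ incomingVelocities (W t) BodyEnd.left},
            ell k (u.1 - W t) * densityChange r a₀ b k W BodyEnd.left t x u :=
        setIntegral_ge_of_const_le_real measurableSet_closedBall measure_closedBall_lt_top.ne
          hslice (hint.mono_set hsub)
    _ ≤ endMomentum r a₀ b k W BodyEnd.left t :=
        setIntegral_mono_set hint (Eventually.of_forall fun x => integral_nonneg fun u =>
          momentum_integrand_left_nonneg hS hε.le hleft x u) hsub.eventuallyLE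

end Force

/-! ### Smallness of the parameters -/

section Assembly

theorem add_rpow_le_two_rpow_mul {x y q : ℝ} (hx : 0 ≤ x) (hy : 0 ≤ y) (hq : 0 ≤ q) :
    (x + y) ^ q ≤ 2 ^ q * (x ^ q + y ^ q) := by
  have hxq := Real.rpow_nonneg hx q
  have hyq := Real.rpow_nonneg hy q
  rcases le_total x y with h | h
  · calc (x + y) ^ q ≤ (2 * y) ^ q := by gcongr; linarith
      _ = 2 ^ q * y ^ q := Real.mul_rpow two_pos.le hy
      _ ≤ _ := by gcongr; linarith
  · calc (x + y) ^ q ≤ (2 * x) ^ q := by gcongr; linarith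
      _ = 2 ^ q * x ^ q := Real.mul_rpow two_pos.le hx
      _ ≤ _ := by gcongr; linarith

/-- The distance to `V_∞`, raised to the power `p + 1`: for large times the exponential part is
negligible in comparison with `t^{-N}`. -/
theorem exists_sub_rpow_le {p N β : ℝ} (hp : 0 < p) (hN : 1 < N) (hβ : 0 < β) {κ : ℝ}
    (hκ : 0 < κ) :
    ∃ T : ℝ, 1 ≤ T ∧ ∀ {Vinf γ A K : ℝ} {W : ℝ → ℝ},
      DecayingMotion Vinf γ (γ ^ (p + 1) * A) β K N W → 0 < γ → γ ≤ 1 → 0 < A → ∀ t, T ≤ t →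
        (W t - Vinf) ^ (p + 1) ≤ κ * γ ^ (p + 1) / t ^ N +
          2 ^ (p + 1) * γ ^ (p + 1) * A ^ (p + 1) / (1 + t) ^ (N * (p + 1)) := by
  obtain ⟨C, hC, hexp⟩ := exists_exp_le_rpow (q := N + 1) hβ (by linarith)
  refine ⟨max 1 (2 ^ (p + 1) * C / κ), le_max_left _ _, ?_⟩
  intro Vinf γ A K W hM hγ hγ1 hA t ht
  have ht1 : 1 ≤ t := (le_max_left _ _).trans ht
  have ht0 : 0 < t := by linarith
  have ht2 : 2 ^ (p + 1) * C / κ ≤ t := (le_max_right _ _).trans ht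
  rw [div_le_iff₀ hκ] at ht2
  have hα : 0 < γ ^ (p + 1) * A := by positivity
  have h1 : (γ * Real.exp (-β * t)) ^ (p + 1) ≤ γ ^ (p + 1) * (C / (t * t ^ N)) := by
    rw [Real.mul_rpow hγ.le (Real.exp_pos _).le]
    gcongr
    have h2 : Real.exp (-β * t) ≤ 1 := by
      rw [Real.exp_le_one_iff]; nlinarith
    calc Real.exp (-β * t) ^ (p + 1) ≤ Real.exp (-β * t) ^ (1 : ℝ) :=
          Real.rpow_le_rpow_of_exponent_ge (Real.exp_pos _) h2 (by linarith)
      _ = Real.exp (-β * t) := Real.rpow_one _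
      _ ≤ C / (1 + t) ^ (N + 1) := hexp t ht0.le
      _ ≤ C / t ^ (N + 1) := by gcongr; linarith
      _ = C / (t * t ^ N) := by rw [Real.rpow_add_one ht0.ne', mul_comm]
  have h3 : (γ ^ (p + 1) * A / (1 + t) ^ N) ^ (p + 1)
      ≤ γ ^ (p + 1) * A ^ (p + 1) / (1 + t) ^ (N * (p + 1)) := by
    rw [Real.div_rpow hα.le (by positivity), Real.mul_rpow (by positivity) hA.le,
      ← Real.rpow_mul (by positivity : 0 ≤ 1 + t)]
    gcongr
    calc γ ^ (p + 1) ≤ γ ^ (1 : ℝ) :=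
          Real.rpow_le_rpow_of_exponent_ge hγ hγ1 (by linarith)
      _ = γ := Real.rpow_one _
  have h5 : 2 ^ (p + 1) * (γ ^ (p + 1) * (C / (t * t ^ N))) ≤ κ * γ ^ (p + 1) / t ^ N := by
    have h6 : 2 ^ (p + 1) * (γ ^ (p + 1) * (C / (t * t ^ N)))
        = (2 ^ (p + 1) * C / t) * γ ^ (p + 1) / t ^ N := by
      field_simp
    rw [h6]
    gcongr
    rw [div_le_iff₀ ht0]
    linarith
  calc (W t - Vinf) ^ (p + 1)
      ≤ (γ * Real.exp (-β * t) + γ ^ (p + 1) * A / (1 + t) ^ N) ^ (p + 1) :=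
        Real.rpow_le_rpow (sub_nonneg.2 (hM.range t).1) (hM.upper t ht0.le) (by linarith)
    _ ≤ 2 ^ (p + 1) * ((γ * Real.exp (-β * t)) ^ (p + 1)
          + (γ ^ (p + 1) * A / (1 + t) ^ N) ^ (p + 1)) :=
        add_rpow_le_two_rpow_mul (by positivity) (by positivity) (by linarith)
    _ ≤ 2 ^ (p + 1) * (γ ^ (p + 1) * (C / (t * t ^ N))
          + γ ^ (p + 1) * A ^ (p + 1) / (1 + t) ^ (N * (p + 1))) := by gcongr
    _ = 2 ^ (p + 1) * (γ ^ (p + 1) * (C / (t * t ^ N)))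
          + 2 ^ (p + 1) * γ ^ (p + 1) * A ^ (p + 1) / (1 + t) ^ (N * (p + 1)) := by ring
    _ ≤ _ := by gcongr

/-- For large times the second term of the upper bound is dominated by the first. -/
theorem exists_bound_nonpos {p N c C A : ℝ} (hp : 0 < p) (hN : 1 < N) (hc : 0 < c) (hC : 0 < C)
    (hA : 0 < A) :
    ∃ T : ℝ, 1 ≤ T ∧ ∀ γ t, 0 < γ → T ≤ t → -c * γ ^ (p + 1) / t ^ N +
      C * γ ^ (p + 1) * A ^ (p + 1) / (1 + t) ^ (N * (p + 1)) ≤ 0 := by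
  set D := C * A ^ (p + 1) / c with hD
  have hD0 : 0 < D := by positivity
  have hNp : 0 < N * p := by positivity
  refine ⟨max 1 (D ^ (N * p)⁻¹), le_max_left _ _, fun γ t hγ ht => ?_⟩
  have ht1 : 1 ≤ t := (le_max_left _ _).trans ht
  have ht0 : 0 < t := by linarith
  have h1 : D ≤ (1 + t) ^ (N * p) := by
    calc D = (D ^ (N * p)⁻¹) ^ (N * p) := (Real.rpow_inv_rpow hD0.le hNp.ne').symm
      _ ≤ (1 + t) ^ (N * p) := by
        gcongr
        linarith [(le_max_right 1 (D ^ (N * p)⁻¹)).trans ht]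
  have h2 : C * γ ^ (p + 1) * A ^ (p + 1) / (1 + t) ^ (N * (p + 1))
      ≤ c * γ ^ (p + 1) / t ^ N := by
    have h4 : (1 + t) ^ (N * (p + 1)) = (1 + t) ^ (N * p) * (1 + t) ^ N := by
      rw [← Real.rpow_add (by positivity)]
      congr 1
      ring
    rw [div_le_div_iff₀ (by positivity) (by positivity), h4]
    have h3 : C * A ^ (p + 1) ≤ c * (1 + t) ^ (N * p) := by
      rw [hD, div_le_iff₀ hc] at h1
      linarith
    calc C * γ ^ (p + 1) * A ^ (p + 1) * t ^ N = (C * A ^ (p + 1)) * (γ ^ (p + 1) * t ^ N) := by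
          ring
      _ ≤ (c * (1 + t) ^ (N * p)) * (γ ^ (p + 1) * (1 + t) ^ N) := by
          gcongr
          linarith
      _ = _ := by ring
  have h3 : -c * γ ^ (p + 1) / t ^ N = -(c * γ ^ (p + 1) / t ^ N) := by ring
  rw [h3]
  linarith

/-- For small `γ` the quantities `γ`, `γ + γ^{p+1} A`, `γ^p A` and `1 / t₀` are small. -/
theorem exists_small_parameter {p A δ a T : ℝ} (hp : 0 < p) (hA : 0 < A) (hδ : 0 < δ)
    (ha : 0 < a) :
    ∃ γ₀ : ℝ, 0 < γ₀ ∧ ∀ γ, 0 < γ → γ < γ₀ → γ ≤ 1 ∧ γ + γ ^ (p + 1) * A ≤ δ ∧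
      γ ^ (p + 1) * A ≤ a * γ ∧ T ≤ startTime γ := by
  refine ⟨min 1 (min (δ / (1 + A)) (min ((a / A) ^ p⁻¹) (Real.exp (-T)))), by positivity,
    fun γ hγ h => ?_⟩
  simp only [lt_min_iff] at h
  obtain ⟨h1, h2, h3, h4⟩ := h
  have h5 : γ ^ (p + 1) ≤ γ := by
    calc γ ^ (p + 1) ≤ γ ^ (1 : ℝ) :=
          Real.rpow_le_rpow_of_exponent_ge hγ h1.le (by linarith)
      _ = γ := Real.rpow_one _
  refine ⟨h1.le, ?_, ?_, ?_⟩
  · rw [lt_div_iff₀ (by positivity)] at h2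
    have : γ ^ (p + 1) * A ≤ γ * A := by gcongr
    linarith
  · have h6 : γ ^ p ≤ a / A := by
      calc γ ^ p ≤ ((a / A) ^ p⁻¹) ^ p := by gcongr
        _ = a / A := Real.rpow_inv_rpow (by positivity) hp.ne'
    rw [le_div_iff₀ hA] at h6
    rw [Real.rpow_add_one hγ.ne']
    nlinarith
  · have h7 : Real.log γ ≤ -T := by
      rw [Real.log_le_iff_le_exp hγ]
      exact h4.le
    rw [startTime]
    linarith [neg_le_abs (Real.log γ)]

end Assembly

end KineticBody

theorem mainTheorem3
    (d : ℕ) (hd : 1 ≤ d) (r : ℝ) (hr : 0 < r)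
    (a₀ : ℝ → ℝ) (b : KineticBody.Transverse d → ℝ) (k : ℝ → ℝ → ℝ)
    (Vinf p γs : ℝ) (hVinf : 0 ≤ Vinf) (hp : 0 < p) (hp2 : p ≤ 2) (hγs : 0 < γs)
    (hStruct : KineticBody.StructureAssumption a₀ b k)
    (hmass : KineticBody.MassConservation b k)
    (hBdd : KineticBody.BoundednessAssumption k γs)
    (hPow : KineticBody.PowerLawAssumption k p γs)
    (hInt : KineticBody.IntegrabilityAssumption a₀ k Vinf γs)
    (hF : KineticBody.ForceConvergence a₀ k Vinf γs)
    (hIrr : KineticBody.IrreversalCriterion a₀ k Vinf) :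
    ∃ c₁ C₂ C : ℝ, 0 < c₁ ∧ 0 < C₂ ∧ 0 < C ∧
      ∀ Aplus Aminus : ℝ, 0 < Aplus → 0 < Aminus →
        ∃ γ₀ : ℝ, 0 < γ₀ ∧ ∀ γ : ℝ, 0 < γ → γ < γ₀ →
          ∀ W : ℝ → ℝ,
            KineticBody.IsAdmissibleMotion r a₀ b k Vinf p Aplus Aminus γ W →
            ∀ t : ℝ, 0 ≤ t →
              KineticBody.PrecollisionForceConverges r a₀ b k W t ∧
              KineticBody.precollisionForce r a₀ b k W t ≤
                (if KineticBody.startTime γ ≤ t then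
                  -c₁ * γ ^ (p + 1) / t ^ (p + (d : ℝ)) +
                    C₂ * γ ^ (p + 1) * Aminus ^ (p + 1) /
                      KineticBody.bracket t ^ ((p + (d : ℝ)) * (p + 1))
                else 0) ∧
              (if KineticBody.startTime γ ≤ t then
                  -c₁ * γ ^ (p + 1) / t ^ (p + (d : ℝ)) +
                    C₂ * γ ^ (p + 1) * Aminus ^ (p + 1) /
                      KineticBody.bracket t ^ ((p + (d : ℝ)) * (p + 1))
                else 0) ≤ 0 ∧
              -(C * (γ + γ ^ (p + 1) * Aminus) ^ (p + 1) /
                  KineticBody.bracket t ^ (p + (d : ℝ))) ≤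
                KineticBody.precollisionForce r a₀ b k W t := by
  open KineticBody in
  have hd1 : (1 : ℝ) ≤ d := by exact_mod_cast hd
  have hN : 1 < p + (d : ℝ) := by linarith
  have hell := continuous_ell hStruct.k_nonneg hp hγs hPow
  obtain ⟨β, K, γ₁, hβ, hK, hγ₁, hrate⟩ := exists_rate_bounds hr hStruct hp hγs hPow hF hIrr
  obtain ⟨G, ε, η₀, hG, hε, hη₀, hdens⟩ :=
    exists_densityChange_bounds hStruct hγs hBdd hInt hIrr
  obtain ⟨Cm, η₁, hCm, hη₁, hmaj⟩ :=
    exists_precollision_majorant hd hr hStruct hIrr hp hp2 hγs hPow hβ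
  obtain ⟨_, Ce, -, hCe, hell2⟩ := exists_ell_two_sided hp hp2 hγs hPow
  obtain ⟨c, T₁, a, hc, ha, hleftlow⟩ :=
    exists_le_endMomentum_left hd hr hStruct hp hp2 hγs hPow hβ hK hε
  set v := volume.real (crossSection d r) with hv
  have hv0 : 0 < v := ENNReal.toReal_pos
    (Metric.measure_closedBall_pos volume _ hr).ne' measure_closedBall_lt_top.ne
  set D := G * Ce * v with hD
  have hD0 : 0 < D := by positivity
  -- half of the force at the left end absorbs the exponential part at the right end
  obtain ⟨T₂, hT₂, hpow⟩ := exists_sub_rpow_le hp hN hβ (κ := c / 2 / D) (by positivity)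
  refine ⟨c / 2, D * 2 ^ (p + 1), 2 * (G * Cm * v), by positivity, by positivity, by positivity,
    fun Aplus Aminus hAp hAm => ?_⟩
  obtain ⟨T₃, hT₃, hneg⟩ := exists_bound_nonpos hp hN (c := c / 2) (C := D * 2 ^ (p + 1))
    (by positivity) (by positivity) hAm
  obtain ⟨γ₂, hγ₂, hsmall⟩ := exists_small_parameter (A := Aminus)
    (δ := min γs (min η₀ η₁)) (a := a) (T := max T₁ (max T₂ T₃)) hp hAm (by positivity) ha
  refine ⟨min γ₁ γ₂, by positivity, fun γ hγ hγlt W₀ hW₀ t ht => ?_⟩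
  obtain ⟨hγ1, hη, hαγ, hT⟩ := hsmall γ hγ (hγlt.trans_le (min_le_right _ _))
  obtain ⟨hmin, hmax⟩ := hrate γ hγ (hγlt.le.trans (min_le_left _ _))
  have hM := hW₀.decayingMotion hp hγ hAp hAm hβ hmin hmax
  set W : ℝ → ℝ := fun t => W₀ (max t 0) with hWdef
  have hWeq : EqOn W₀ W (Ici 0) := fun t ht => by
    rw [hWdef]; simp only [max_eq_left (mem_Ici.1 ht)]
  rw [precollisionForce_congr hWeq ht, precollisionForceConverges_congr hWeq ht]
  set α := γ ^ (p + 1) * Aminus with hα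
  have hα0 : 0 < α := by positivity
  have hη' : γ + α ≤ γs := hη.trans (min_le_left _ _)
  have hbnd := fun t x u => hdens (γ + α) (by positivity)
    (hη.trans ((min_le_right _ _).trans (min_le_left _ _))) r W hM.continuous hM.range t x u
  have hδ : ∀ e t x u, |densityChange r a₀ b k W e t x u| ≤ G * b u.2 := fun e t x u =>
    (hbnd t x u).2.1 e
  have hleft := fun t x u => (hbnd t x u).2.2
  have hL0 := endMomentum_left_nonneg (t := t) hStruct hε.le hleft
  have habs : ∀ e, |endMomentum r a₀ b k W e t|
      ≤ G * (Cm * (γ + α) ^ (p + 1) / (1 + t) ^ (p + (d : ℝ))) * v := by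
    intro e
    refine abs_endMomentum_le hStruct hG.le hδ fun x hx => ?_
    obtain ⟨g, h1, h2, h3, h4⟩ := hmaj hM hγ hα0
      (hη.trans ((min_le_right _ _).trans (min_le_right _ _))) t ht x hx
    exact ⟨g, h1, h2, h3, fun u _ => h4 u⟩
  refine ⟨precollisionForceConverges hStruct hell hM.continuous hM.range hG.le
    (fun e t x u => (hbnd t x u).1 e) hδ, ?_, ?_, ?_⟩
  · rw [precollisionForce_eq]
    split_ifs with hst
    · have hTt := hT.trans hst
      have h1 := hleftlow hM hγ hα0 (by linarith) hαγ hG.le hδ hleft t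
        ((le_max_left _ _).trans hTt)
      have h2 := abs_endMomentum_right_le (t := t) hStruct hell hp hCe
        (fun w hw => (hell2 w hw).2) hM.continuous hM.range hη' hG.le hδ
      have h3 := hpow hM hγ hγ1 hAm t
        (((le_max_left _ _).trans (le_max_right _ _)).trans hTt)
      have h4 : endMomentum r a₀ b k W BodyEnd.right t ≤ D * (W t - Vinf) ^ (p + 1) := by
        refine (le_abs_self _).trans (h2.trans_eq ?_)
        rw [hD]; ring
      have h5 := mul_le_mul_of_nonneg_left h3 hD0.le
      have h6 : D * (c / 2 / D * γ ^ (p + 1) / t ^ (p + (d : ℝ)) + 2 ^ (p + 1) * γ ^ (p + 1) *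
          Aminus ^ (p + 1) / (1 + t) ^ ((p + (d : ℝ)) * (p + 1)))
          = c / 2 * γ ^ (p + 1) / t ^ (p + (d : ℝ)) + D * 2 ^ (p + 1) * γ ^ (p + 1) *
          Aminus ^ (p + 1) / (1 + t) ^ ((p + (d : ℝ)) * (p + 1)) := by
        rw [mul_add]
        congr 1
        · field_simp
        · ring
      have h7 : c * γ ^ (p + 1) / t ^ (p + (d : ℝ)) = 2 * (c / 2 * γ ^ (p + 1) /
          t ^ (p + (d : ℝ))) := by ring
      have h8 : -(c / 2) * γ ^ (p + 1) / t ^ (p + (d : ℝ)) = -(c / 2 * γ ^ (p + 1) /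
          t ^ (p + (d : ℝ))) := by ring
      rw [bracket, h8]
      linarith
    · have hanti : AntitoneOn W (Icc 0 t) := by
        intro x hx y hy hxy
        rw [← hWeq (mem_Ici.2 hx.1), ← hWeq (mem_Ici.2 hy.1)]
        exact hW₀.decreasing ⟨hx.1, by linarith [hx.2]⟩ ⟨hy.1, by linarith [hy.2]⟩ hxy
      rw [endMomentum_right_eq_zero hStruct (ell_zero hStruct.k_nonneg hp hγs hPow)
        hM.continuous hanti]
      linarith
  · split_ifs with hst
    · rw [bracket]
      exact hneg γ t hγ (((le_max_right _ _).trans (le_max_right _ _)).trans (hT.trans hst))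
    · exact le_rfl
  · rw [precollisionForce_eq, bracket]
    have h1 := (le_abs_self _).trans (habs BodyEnd.left)
    have h2 := (neg_le_of_abs_le (habs BodyEnd.right))
    have h3 : 2 * (G * Cm * v) * (γ + α) ^ (p + 1) / (1 + t) ^ (p + (d : ℝ))
        = 2 * (G * (Cm * (γ + α) ^ (p + 1) / (1 + t) ^ (p + (d : ℝ))) * v) := by ring
    rw [h3]
    linarith
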